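/- **Proposition ($\mathrm{B}_r$ summation).** Let $r$ be a positive integer and $n$ an integer or half-integer (that is, $2n\in\mathbb{Z}$) with $n\ge r-\tfrac12$. Below, all sums over $k_1,\dots,k_r$ run over $k_i\in\{-n,-n+1,\dots,n\}$. For $0<q<1$ write $(a;q)_m=\prod_{k=1}^m(1-aq^{k-1})$ for integers $m\ge0$, $(a;q)_{-m}=\prod_{k=1}^m(1-aq^{-k})^{-1}$ for $m\ge1$, and $(a;q)_\infty=\prod_{k\ge1}(1-aq^{k-1})$. Put $[x]_q=\frac{1-q^x}{1-q}$ and $\Gamma_q(x)=(1-q)^{1-x}\frac{(q;q)_\infty}{(q^x;q)_\infty}$ for real $x$ (away from poles), $\binom{x}{2}=\frac{x(x-1)}2$ for real $x$, and $\left[{N\atop m}\right]_q=\frac{(q^{N-m+1};q)_m}{(q;q)_m}$ for integers $0\le m\le N$. Then, for all $0<q<1$, $$\sum_{k_1,\dots,k_r=-n}^{n}\ \prod_{1\le i<j\le r}\bigl|[k_i-k_j]_q\,[k_i+k_j]_q\bigr|\ \prod_{i=1}^r\bigl|[k_i]_q\bigr|\,q^{\binom{k_i-r+i}{2}-\binom{\lceil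 n\rceil-n}{2}}\left[{2n\atop n+k_i}\right]_q$$ $$=2^r\,r!\,\prod_{i=1}^r(-q;q^{1/2})_{2n-2i}\ \frac{\Gamma_q(i)}{\Gamma_q(\frac32)}\cdot\frac{\Gamma_q(2n+1)\,\Gamma_q(\lceil n\rceil-i+\frac32)}{\Gamma_q(2n-i+2)\,\Gamma_q(\lceil n\rceil-i+1)}.$$ Moreover, at $q=1$, for $$\mathcal S_{r,n}(\alpha,\gamma,\delta):=\sum_{k_1,\dots,k_r=-n}^{n}\ \prod_{1\le i<j\le r}|k_i^\alpha-k_j^\alpha|^{2\gamma}\ \prod_{i=1}^r|k_i|^\delta\binom{2n}{n+k_i}$$ one has $$\mathcal S_{r,n}(2,\tfrac12,1)=2^{(2n+1)r-r(r+1)}\prod_{i=1}^r\frac{\Gamma(1+i)}{\Gamma(\frac32)}\cdot\frac{\Gamma(2n+1)\,\Gamma(\lceil n\rceil-i+\frac32)}{\Gamma(2n-i+2)\,\Gamma(\lceil n\rceil-i+1)}.$$ (For integer $n$, $\lceil n\rceil=n$.) -/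

import Mathlib

noncomputable section

namespace MacdonaldMehta

/-- The finite `q`-shifted factorial `(a;q)_n = ∏_{k=1}^n (1 - a q^(k-1))` for `n ≥ 0`, with the
standard extension `(a;q)_(-n) = 1 / ∏_{k=1}^n (1 - a q^(-k))` to negative indices
(so that `(a;q)_(n+1) = (a;q)_n * (1 - a q^n)` for all integers `n`, away from zero factors). -/
def qPoch (a q : ℝ) : ℤ → ℝ
  | Int.ofNat n => ∏ k ∈ Finset.range n, (1 - a * q ^ k)
  | Int.negSucc n => (∏ k ∈ Finset.range (n + 1), (1 - a / q ^ (k + 1)))⁻¹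

/-- The infinite `q`-shifted factorial `(a;q)_∞ = ∏_{k ≥ 1} (1 - a q^(k-1))`. -/
def qPochInf (a q : ℝ) : ℝ := ∏' k : ℕ, (1 - a * q ^ k)

/-- The infinite product defining `(a;q)_∞` converges for `0 < q < 1`. -/
theorem multipliable_qPochInf (a q : ℝ) (h0 : 0 < q) (h1 : q < 1) :
    Multipliable fun k : ℕ => (1 - a * q ^ k) := by
  have h : Summable fun k : ℕ => -(a * q ^ k) :=
    ((summable_geometric_of_lt_one h0.le h1).mul_left a).neg
  simpa [sub_eq_add_neg] using Real.multipliable_one_add_of_summable h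

/-- The `q`-binomial coefficient `[n, m]_q = (q^(n-m+1);q)_m / (q;q)_m`. -/
def qBinom (q : ℝ) (n m : ℕ) : ℝ :=
  qPoch (q ^ ((n : ℤ) - m + 1)) q m / qPoch q q m

/-- The `q`-gamma function `Γ_q(x) = (1-q)^(1-x) (q;q)_∞ / (q^x;q)_∞`. -/
def qGamma (q x : ℝ) : ℝ :=
  (1 - q) ^ (1 - x) * qPochInf q q / qPochInf (q ^ x) q

/-- The `q`-number `[x]_q = (1 - q^x) / (1 - q)`, for real `x`. -/
def qNum (q x : ℝ) : ℝ := (1 - q ^ x) / (1 - q)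

/-- `binom(x,2) = x(x-1)/2`, for real `x`. -/
def choose2 (x : ℝ) : ℝ := x * (x - 1) / 2

/-- For `n = N/2` the numbers `-n, -n+1, …, n` are the `j - N/2` with `j ∈ {0, …, N}`;
this is the tuple `(k_1, …, k_r)` that belongs to `(j_1, …, j_r)`, and `n + k_i = j_i`. -/
def kTuple {r N : ℕ} (j : Fin r → Fin (N + 1)) (i : Fin r) : ℝ := ((j i : ℕ) : ℝ) - (N : ℝ) / 2

/-- `Δ(x) = ∏_{i<j} (x_i - x_j)`. -/
def vdm {r : ℕ} (x : Fin r → ℝ) : ℝ := ∏ i : Fin r, ∏ j ∈ Finset.Ioi i, (x i - x j)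

/-- The discrete Macdonald--Mehta integral `S_{r,n}(α,γ,δ)` with `n = N/2`:
the sum over `k_1, …, k_r ∈ {-n, -n+1, …, n}` of
`|Δ(k^α)|^(2γ) ∏_i |k_i|^δ binom(2n, n+k_i)`. -/
def discreteMM (r N : ℕ) (α : ℕ) (γ δ : ℝ) : ℝ :=
  ∑ j : Fin r → Fin (N + 1),
    |vdm (fun i => kTuple j i ^ α)| ^ (2 * γ) *
      ∏ i : Fin r, |kTuple j i| ^ δ * (N.choose (j i) : ℝ)

/-- The `q`-analogue of `S_{r,n}(2,1/2,1)` with `n = N/2`: the sum over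
`k_1, …, k_r ∈ {-n, -n+1, …, n}` of `∏_{i<j} |[k_i-k_j]_q [k_i+k_j]_q|` times
`∏_i |[k_i]_q| q^(binom(k_i-r+i,2) - binom(⌈n⌉-n,2)) [2n, n+k_i]_q`.
(The index `i` of `Fin r` counts from zero, so the index `i` of the formula is `i + 1` in the code.) -/
def qSumB (q : ℝ) (r N : ℕ) : ℝ :=
  ∑ j : Fin r → Fin (N + 1),
    (∏ i : Fin r, ∏ l ∈ Finset.Ioi i,
      |qNum q (kTuple j i - kTuple j l) * qNum q (kTuple j i + kTuple j l)|) *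
    ∏ i : Fin r,
      |qNum q (kTuple j i)| *
      q ^ (choose2 (kTuple j i - r + ((i : ℕ) + 1)) -
            choose2 ((⌈(N : ℝ) / 2⌉ : ℝ) - (N : ℝ) / 2)) *
      qBinom q N (j i)

end MacdonaldMehta

end

/-! Write `n = L + ε/2` with `ε ∈ {1, 2}`. The summand depends on each `k` only up to sign (in the
`q`-case after the asymmetric powers of `q` have been balanced), and `k = 0` has weight zero. So the
sum folds to `2^r` times a sum over `t ∈ {0, …, L}`, where `k = t + ε/2`. By symmetry this is `r!`
times a sum over strictly increasing tuples, on which the absolute values can be removed.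

There the summand is a determinant of differences. Put `g l t = y t / (F (l+t+ε-1) F (l-t))` for `t
≤ l` and zero beyond, where `F` is the factorial or `(q;q)_n`. Then `g (L-p) t - g (L-p) (t+1)` is a
constant times the one-variable weight at `t` times a polynomial of degree `p` in `u t`. Here `u` is
`k^2`, respectively `q^k + q^(-k)`. The determinant in `p` and the `t_j` is therefore a Vandermonde
product times the weights.

Moreover `g l (t+1) / g l t = (α l - α t) / (α l + α t)` for `t ≤ l`, with `α` equal to `2k`,
respectively `(1-q^k)/(1+q^k)`. For such functions the sum of the determinants has the closed form
`∏ g_i(0) · ∏_{i<j} (a_j - a_i)/(a_j + a_i)`, a Schur Pfaffian type product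
(`sum_strictChains_det`). Its inductive step is a partial fraction identity (`sum_lagrange_eq`).

`sum_type_B` packages this for both cases. What remains is to recognise the product, which uses
duplication formulas for the factorial and its `q`-analogue. -/

open Finset

namespace MacdonaldMehta

/-! ### Partial fractions and Schur's product -/

/-- A partial fraction identity, obtained by Lagrange interpolation at the points `a i`. -/
theorem sum_lagrange_eq {ι : Type*} [Fintype ι] [DecidableEq ι] (a : ι → ℝ)
    (hinj : Function.Injective a) (h0 : ∀ i, a i ≠ 0) (c : ℝ) :
    ∑ i, 2 * c * ∏ l ∈ univ.erase i, ((a l - c) * ((a l + a i) / (a l - a i))) =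
      ∏ l, (a l + c) - ∏ l, (a l - c) := by
  classical
  -- `Q` vanishes at `0`, so `Q / X` has degree below the number of nodes and is determined by its
  -- values at the `a i`; there the second product in `Q` is zero.
  let Q : Polynomial ℝ := ∏ l, (Polynomial.C (a l) + Polynomial.X) -
    ∏ l, (Polynomial.C (a l) - Polynomial.X)
  have hQeval : ∀ x, Q.eval x = ∏ l, (a l + x) - ∏ l, (a l - x) := by
    intro x
    simp [Q, Polynomial.eval_prod]
  have hQX : Q.divX * Polynomial.X = Q := by
    have h := Polynomial.divX_mul_X_add Q
    have h' : Q.coeff 0 = 0 := by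
      rw [Polynomial.coeff_zero_eq_eval_zero, hQeval]
      simp
    rw [h'] at h
    simpa using h
  have hR : ∀ x, Q.divX.eval x * x = ∏ l, (a l + x) - ∏ l, (a l - x) := by
    intro x
    rw [← hQeval, ← congrArg (Polynomial.eval x) hQX]
    simp
  have hdegQ : Q.natDegree ≤ Fintype.card ι := by
    refine (Polynomial.natDegree_sub_le _ _).trans (max_le ?_ ?_)
    · refine (Polynomial.natDegree_prod_le _ _).trans ?_
      refine (Finset.sum_le_card_nsmul _ _ 1 fun i _ => ?_).trans (by simp)
      exact (Polynomial.natDegree_add_le _ _).trans (by simp)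
    · refine (Polynomial.natDegree_prod_le _ _).trans ?_
      refine (Finset.sum_le_card_nsmul _ _ 1 fun i _ => ?_).trans (by simp)
      exact (Polynomial.natDegree_sub_le _ _).trans (by simp)
  have hRa : ∀ i, Q.divX.eval (a i) = 2 * ∏ l ∈ univ.erase i, (a l + a i) := by
    intro i
    have h := hR (a i)
    rw [Finset.prod_eq_zero (s := univ) (f := fun l => a l - a i) (mem_univ i) (sub_self _),
      sub_zero, ← Finset.mul_prod_erase _ _ (mem_univ i)] at h
    apply mul_right_cancel₀ (h0 i)
    rw [h]
    ring
  rcases isEmpty_or_nonempty ι with hι | hι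
  · simp
  have hdeg : Q.divX.degree < (univ : Finset ι).card := by
    rw [Finset.card_univ]
    have hpos : 0 < Fintype.card ι := Fintype.card_pos
    refine (Polynomial.degree_le_natDegree).trans_lt ?_
    rw [Polynomial.natDegree_divX_eq_natDegree_tsub_one]
    exact_mod_cast (by omega : Q.natDegree - 1 < Fintype.card ι)
  have hint := Lagrange.eq_interpolate_of_eval_eq (s := univ) (v := a)
    (fun i => 2 * ∏ l ∈ univ.erase i, (a l + a i)) (hinj.injOn) hdeg (fun i _ => hRa i)
  rw [← hR c, hint, Lagrange.interpolate_apply, Polynomial.eval_finsetSum, Finset.sum_mul]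
  refine Finset.sum_congr rfl fun i _ => ?_
  rw [Polynomial.eval_mul, Polynomial.eval_C, Lagrange.basis, Polynomial.eval_prod]
  have : ∀ l ∈ univ.erase i, Polynomial.eval c (Lagrange.basisDivisor (a i) (a l)) =
      (a l - c) / (a l - a i) := by
    intro l hl
    have hne : a l - a i ≠ 0 := sub_ne_zero.2 fun h => (ne_of_mem_erase hl) (hinj h)
    have hne' : a i - a l ≠ 0 := by rw [← neg_sub]; exact neg_ne_zero.2 hne
    simp only [Lagrange.basisDivisor, Polynomial.eval_mul, Polynomial.eval_C, Polynomial.eval_sub,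
      Polynomial.eval_X]
    field_simp
    ring
  rw [Finset.prod_congr rfl this]
  have h2 : ∏ l ∈ univ.erase i, ((a l - c) * ((a l + a i) / (a l - a i))) =
      (∏ l ∈ univ.erase i, (a l + a i)) * ∏ l ∈ univ.erase i, (a l - c) / (a l - a i) := by
    rw [← Finset.prod_mul_distrib]
    exact Finset.prod_congr rfl fun l _ => by ring
  rw [h2]
  ring

/-- Splitting off the pairs that contain a given index from a product over pairs. -/
theorem prod_pairs_succAbove {r : ℕ} (f : Fin (r + 1) → Fin (r + 1) → ℝ) (i : Fin (r + 1)) :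
    ∏ p, ∏ j ∈ Ioi p, f p j =
      (∏ l : Fin r, if i.succAbove l < i then f (i.succAbove l) i else f i (i.succAbove l)) *
        ∏ l : Fin r, ∏ l' ∈ Ioi l, f (i.succAbove l) (i.succAbove l') := by
  have key : ∀ (m : ℕ) (h : Fin m → Fin m → ℝ),
      ∏ p, ∏ j ∈ Ioi p, h p j = ∏ p, ∏ j, if p < j then h p j else 1 := by
    intro m h
    refine Finset.prod_congr rfl fun p _ => ?_
    rw [← Finset.prod_filter]
    refine Finset.prod_congr ?_ fun _ _ => rfl
    ext; simp
  rw [key, key, Fin.prod_univ_succAbove _ i, Fin.prod_univ_succAbove _ i]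
  simp_rw [fun l : Fin r => Fin.prod_univ_succAbove (fun j => if i.succAbove l < j then
    f (i.succAbove l) j else 1) i]
  rw [Finset.prod_mul_distrib]
  simp only [lt_irrefl, if_false, one_mul, (Fin.strictMono_succAbove i).lt_iff_lt]
  rw [← mul_assoc, ← Finset.prod_mul_distrib]
  congr 1
  refine Finset.prod_congr rfl fun l _ => ?_
  rcases lt_or_gt_of_ne (Fin.succAbove_ne i l) with h | h
  · simp [h, not_lt.2 h.le]
  · simp [h, not_lt.2 h.le]

/-- The product of all `(a_j - a_i) / (a_j + a_i)` with `i < j`. -/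
noncomputable def schurProd {r : ℕ} (a : Fin r → ℝ) : ℝ :=
  ∏ i, ∏ j ∈ Ioi i, ((a j - a i) / (a j + a i))

theorem prod_sign_succAbove {r : ℕ} (i : Fin (r + 1)) :
    (∏ l : Fin r, if i.succAbove l < i then (-1 : ℝ) else 1) = (-1) ^ (i : ℕ) := by
  simp only [Fin.succAbove_lt_iff_castSucc_lt]
  simp only [Fin.lt_def, Fin.val_castSucc]
  rw [Fin.prod_univ_eq_prod_range (fun l => if l < (i : ℕ) then (-1 : ℝ) else 1),
    Finset.prod_ite, Finset.prod_const, Finset.prod_const_one, mul_one]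
  have h : (range r).filter (fun l => l < (i : ℕ)) = range i := by
    ext x
    simp
    omega
  rw [h, card_range]

/-- Each pair `(l, i)` with `l < i` occurs in the opposite orientation, at the cost of one sign. The
resulting `(-1)^i` is the sign of the Laplace expansion along the first column, so the two cancel in
`sum_strictChains_det`. -/
theorem schurProd_succAbove {r : ℕ} (a : Fin (r + 1) → ℝ) (i : Fin (r + 1)) :
    schurProd a = (-1) ^ (i : ℕ) * (∏ l ∈ univ.erase i, ((a l - a i) / (a l + a i))) *
      schurProd (fun l => a (i.succAbove l)) := by
  rw [schurProd, prod_pairs_succAbove _ i, schurProd]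
  congr 1
  have himg : (univ.erase i : Finset (Fin (r + 1))) = univ.map i.succAboveEmb := by
    ext x; simp [Fin.exists_succAbove_eq_iff]
  rw [← prod_sign_succAbove, himg, Finset.prod_map, ← Finset.prod_mul_distrib]
  refine Finset.prod_congr rfl fun l _ => ?_
  simp only [Fin.succAboveEmb_apply]
  split_ifs
  · rw [add_comm (a i), neg_one_mul, ← neg_div, neg_sub]
  · rw [one_mul]

/-! ### Sums of determinants over strictly increasing tuples -/

open Classical in
/-- Strictly increasing `r`-tuples with entries in `[b, M)`. -/
noncomputable def strictChains (r b M : ℕ) : Finset (Fin r → ℕ) :=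
  (Fintype.piFinset fun _ => Ico b M).filter StrictMono

theorem mem_strictChains {r b M : ℕ} {k : Fin r → ℕ} :
    k ∈ strictChains r b M ↔ (∀ i, b ≤ k i ∧ k i < M) ∧ StrictMono k := by
  simp [strictChains]

theorem cons_mem_strictChains {r b M : ℕ} (hb : b < M) {k : Fin r → ℕ} :
    (Fin.cons b k : Fin (r + 1) → ℕ) ∈ strictChains (r + 1) b M ↔
      k ∈ strictChains r (b + 1) M := by
  simp only [mem_strictChains, Fin.forall_fin_succ, Fin.cons_zero, Fin.cons_succ]
  constructor
  · rintro ⟨⟨_, h⟩, hm⟩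
    refine ⟨fun i => ⟨?_, (h i).2⟩, fun i j hij => ?_⟩
    · have := hm (Fin.succ_pos i)
      simpa using this
    · have := hm (Fin.succ_lt_succ_iff.2 hij)
      simpa using this
  · rintro ⟨h, hm⟩
    refine ⟨⟨⟨le_rfl, hb⟩, fun i => ⟨by have := (h i).1; omega, (h i).2⟩⟩, ?_⟩
    intro i j hij
    induction i using Fin.cases with
    | zero =>
      induction j using Fin.cases with
      | zero => exact absurd hij (lt_irrefl _)
      | succ j => simpa using (h j).1
    | succ i =>
      induction j using Fin.cases with
      | zero => exact absurd hij (by simp)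
      | succ j => simpa using hm (Fin.succ_lt_succ_iff.1 hij)

theorem sum_strictChains_succ {r b M : ℕ} (hb : b < M) (F : (Fin (r + 1) → ℕ) → ℝ) :
    ∑ k ∈ strictChains (r + 1) b M, F k =
      ∑ k ∈ strictChains (r + 1) (b + 1) M, F k +
        ∑ k ∈ strictChains r (b + 1) M, F (Fin.cons b k) := by
  rw [← Finset.sum_filter_add_sum_filter_not _ (fun k => k 0 ≠ b)]
  congr 1
  · refine Finset.sum_congr ?_ fun _ _ => rfl
    ext k
    simp only [mem_filter, mem_strictChains]
    constructor
    · rintro ⟨⟨h, hm⟩, h0⟩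
      refine ⟨fun i => ⟨?_, (h i).2⟩, hm⟩
      have h1 := hm.monotone (Fin.zero_le i)
      have h2 := (h 0).1
      omega
    · rintro ⟨h, hm⟩
      refine ⟨⟨fun i => ⟨by have := (h i).1; omega, (h i).2⟩, hm⟩, ?_⟩
      have := (h 0).1
      omega
  · refine Finset.sum_nbij' (fun k => Fin.tail k) (fun k => Fin.cons b k) ?_ ?_ ?_ ?_ ?_
    · intro k hk
      simp only [mem_filter, not_not] at hk
      rw [← cons_mem_strictChains hb, ← hk.2, Fin.cons_self_tail, hk.2]
      exact hk.1
    · intro k hk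
      simp [cons_mem_strictChains hb, hk]
    · intro k hk
      simp only [mem_filter, not_not] at hk
      rw [← hk.2, Fin.cons_self_tail]
    · intro k _
      simp
    · intro k hk
      simp only [mem_filter, not_not] at hk
      rw [← hk.2, Fin.cons_self_tail]

theorem strictChains_zero (b M : ℕ) : strictChains 0 b M = {Fin.elim0} := by
  ext k
  simp only [mem_strictChains, mem_singleton]
  exact ⟨fun _ => Subsingleton.elim _ _, fun _ => ⟨fun i => i.elim0, fun i => i.elim0⟩⟩

theorem strictChains_succ_of_le {r b M : ℕ} (h : M ≤ b) : strictChains (r + 1) b M = ∅ := by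
  ext k
  simp only [mem_strictChains, notMem_empty, iff_false]
  intro hk
  have := hk.1 0
  omega

/-- The sum over strict chains of the determinants of the differences of the `g i` factorises,
when all the ratios `g i (t + 1) / g i t` have the form `(a i - c t) / (a i + c t)`. -/
theorem sum_strictChains_det (M : ℕ) (c : ℕ → ℝ) (hc : ∀ t < M, 0 < c t) (r : ℕ) :
    ∀ (a : Fin r → ℝ) (g : Fin r → ℕ → ℝ), Function.Injective a → (∀ i, 0 < a i) →
      (∀ i, ∀ t < M, g i (t + 1) * (a i + c t) = g i t * (a i - c t)) →
      (∀ i, g i M = 0) → ∀ b ≤ M,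
      ∑ k ∈ strictChains r b M, (Matrix.of fun i j => g i (k j) - g i (k j + 1)).det =
        (∏ i, g i b) * schurProd a := by
  induction r with
  | zero =>
    intro a g _ _ _ _ b _
    simp [strictChains_zero, schurProd]
  | succ r ih =>
    intro a g hinj hpos hrec hM b hb
    induction hb using Nat.decreasingInduction with
    | self =>
      rw [strictChains_succ_of_le le_rfl, Finset.sum_empty,
        Finset.prod_eq_zero (mem_univ 0) (hM 0), zero_mul]
    | of_succ b hb ihb =>
      have hbM : b < M := hb
      -- Chains starting above `b` are covered by the descending induction on `b`. Those starting at
      -- `b` are expanded along the first column, and the minors are summed by the induction on `r`.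
      rw [sum_strictChains_succ hbM, ihb]
      have hac : ∀ i, a i + c b ≠ 0 := fun i => (add_pos (hpos i) (hc b hbM)).ne'
      have hg : ∀ i, g i (b + 1) = g i b * ((a i - c b) / (a i + c b)) := by
        intro i
        rw [← mul_div_assoc, eq_div_iff (hac i), hrec i b hbM]
      have hdet : ∀ k : Fin r → ℕ,
          (Matrix.of fun i j => g i ((Fin.cons b k : Fin (r + 1) → ℕ) j) -
            g i ((Fin.cons b k : Fin (r + 1) → ℕ) j + 1)).det =
          ∑ i : Fin (r + 1), (-1) ^ (i : ℕ) * (g i b - g i (b + 1)) *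
            (Matrix.of fun i' j => g (i.succAbove i') (k j) - g (i.succAbove i') (k j + 1)).det := by
        intro k
        rw [Matrix.det_succ_column_zero]
        rfl
      simp_rw [hdet]
      rw [Finset.sum_comm]
      have hi : ∀ i : Fin (r + 1), ∑ k ∈ strictChains r (b + 1) M,
          (-1) ^ (i : ℕ) * (g i b - g i (b + 1)) *
            (Matrix.of fun i' j => g (i.succAbove i') (k j) - g (i.succAbove i') (k j + 1)).det =
          (∏ l, g l b) * schurProd a * (∏ l, (a l + c b))⁻¹ *
            (2 * c b * ∏ l ∈ univ.erase i, ((a l - c b) * ((a l + a i) / (a l - a i)))) := by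
        intro i
        rw [← Finset.mul_sum, ih (fun l => a (i.succAbove l)) (fun l => g (i.succAbove l))
          (hinj.comp Fin.succAbove_right_injective) (fun _ => hpos _) (fun _ => hrec _)
          (fun _ => hM _) (b + 1) hbM, schurProd_succAbove a i]
        have himg : (univ.erase i : Finset (Fin (r + 1))) = univ.map i.succAboveEmb := by
          ext x; simp [Fin.exists_succAbove_eq_iff]
        have hs : ∏ l ∈ univ.erase i, ((a l - a i) / (a l + a i)) ≠ 0 := by
          refine Finset.prod_ne_zero_iff.2 fun l hl => div_ne_zero ?_ (add_pos (hpos l) (hpos i)).ne'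
          exact sub_ne_zero.2 fun h => (ne_of_mem_erase hl) (hinj h)
        have hs' : ∏ l ∈ univ.erase i, ((a l + a i) / (a l - a i)) =
            (∏ l ∈ univ.erase i, ((a l - a i) / (a l + a i)))⁻¹ := by
          rw [← Finset.prod_inv_distrib]
          exact Finset.prod_congr rfl fun l _ => (inv_div _ _).symm
        have hprod : ∏ l : Fin r, g (i.succAbove l) (b + 1) =
            (∏ l ∈ univ.erase i, g l b) * (∏ l ∈ univ.erase i, (a l - c b)) *
              (∏ l ∈ univ.erase i, (a l + c b))⁻¹ := by
          have h1 : ∏ l : Fin r, g (i.succAbove l) (b + 1) =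
              ∏ l ∈ univ.erase i, g l (b + 1) := by
            rw [himg, Finset.prod_map]; rfl
          rw [h1, ← Finset.prod_inv_distrib, ← Finset.prod_mul_distrib, ← Finset.prod_mul_distrib]
          refine Finset.prod_congr rfl fun l _ => ?_
          rw [hg l]
          ring
        rw [hprod, Finset.prod_mul_distrib, hs', ← Finset.mul_prod_erase univ (fun l => g l b)
          (mem_univ i), ← Finset.mul_prod_erase univ (fun l => a l + c b) (mem_univ i), hg i]
        have hai := hac i
        have hsc : ∏ l ∈ univ.erase i, (a l + c b) ≠ 0 :=
          Finset.prod_ne_zero_iff.2 fun l _ => hac l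
        field_simp
        ring
      -- The expansion contributes the common factor times `∏ (a l + c b) - ∏ (a l - c b)`; the
      -- chains starting above `b` supply exactly the missing `∏ (a l - c b)`.
      rw [Finset.sum_congr rfl fun i _ => hi i, ← Finset.mul_sum,
        sum_lagrange_eq a hinj (fun i => (hpos i).ne')]
      have hP : ∏ l, (a l + c b) ≠ 0 := Finset.prod_ne_zero_iff.2 fun l _ => hac l
      rw [Finset.prod_congr rfl fun i _ => hg i, Finset.prod_mul_distrib, Finset.prod_div_distrib]
      field_simp
      ring

/-! ### Symmetrisation and the Vandermonde determinant -/

/-- A symmetric function that vanishes on non-injective tuples, summed over all tuples. -/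
theorem sum_piFinset_eq_factorial_mul (r M : ℕ) (F : (Fin r → ℕ) → ℝ)
    (hsymm : ∀ (k : Fin r → ℕ) (σ : Equiv.Perm (Fin r)), F (k ∘ σ) = F k)
    (hinj : ∀ k : Fin r → ℕ, ¬ Function.Injective k → F k = 0) :
    ∑ k ∈ Fintype.piFinset (fun _ : Fin r => range M), F k =
      (r.factorial : ℝ) * ∑ k ∈ strictChains r 0 M, F k := by
  classical
  have h1 : ∀ k : Fin r → ℕ,
      F k = ∑ σ : Equiv.Perm (Fin r), if StrictMono (k ∘ σ) then F (k ∘ σ) else 0 := by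
    intro k
    by_cases hk : Function.Injective k
    -- Exactly one permutation sorts an injective tuple.
    · rw [Finset.sum_eq_single (Tuple.sort k)]
      · rw [if_pos ((Tuple.monotone_sort k).strictMono_of_injective
          (hk.comp (Tuple.sort k).injective)), hsymm]
      · intro σ _ hσ
        rw [if_neg]
        intro hm
        apply hσ
        have := Tuple.unique_monotone hm.monotone (Tuple.monotone_sort k)
        ext i
        exact congrArg Fin.val (hk (congrFun this i))
      · simp
    · rw [hinj k hk, Finset.sum_eq_zero]
      intro σ _
      rw [hsymm, hinj k hk, ite_self]
  rw [Finset.sum_congr rfl fun k _ => h1 k, Finset.sum_comm]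
  have h2 : ∀ σ : Equiv.Perm (Fin r), ∑ k ∈ Fintype.piFinset (fun _ : Fin r => range M),
      (if StrictMono (k ∘ σ) then F (k ∘ σ) else 0) = ∑ k ∈ strictChains r 0 M, F k := by
    intro σ
    rw [strictChains, Finset.sum_filter]
    refine Finset.sum_nbij' (fun k => k ∘ σ) (fun k => k ∘ σ.symm) ?_ ?_ ?_ ?_ ?_
    · intro k hk
      simp only [Fintype.mem_piFinset, mem_range, mem_Ico, Function.comp] at hk ⊢
      exact fun i => ⟨Nat.zero_le _, hk _⟩
    · intro k hk
      simp only [Fintype.mem_piFinset, mem_range, mem_Ico, Function.comp] at hk ⊢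
      exact fun i => (hk _).2
    · intro k _
      funext i
      simp
    · intro k _
      funext i
      simp
    · intro k _
      rfl
  rw [Finset.sum_congr rfl fun σ _ => h2 σ, Finset.sum_const, Finset.card_univ,
    Fintype.card_perm, Fintype.card_fin, nsmul_eq_mul]

/-- Row `i` evaluates a polynomial that is monic of degree `i` in `-u j`, so row operations reduce
the matrix to a Vandermonde matrix in the `-u j`. -/
theorem det_prod_sub_eq {r : ℕ} (U : ℕ → ℝ) (u : Fin r → ℝ) :
    (Matrix.of fun i j : Fin r => ∏ p ∈ range i, (U p - u j)).det =
      ∏ i, ∏ j ∈ Ioi i, (u i - u j) := by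
  let P : Fin r → Polynomial ℝ := fun j => ∏ p ∈ range j, (Polynomial.X + Polynomial.C (U p))
  have hmon : ∀ j, (P j).Monic := fun j =>
    Polynomial.monic_prod_of_monic _ _ fun p _ => Polynomial.monic_X_add_C _
  have hdeg : ∀ j, (P j).natDegree = j := by
    intro j
    rw [Polynomial.natDegree_prod_of_monic _ _ fun p _ => Polynomial.monic_X_add_C _]
    simp
  have h := Matrix.det_eval_matrixOfPolynomials_eq_det_vandermonde (fun i => -u i) P hdeg hmon
  rw [Matrix.det_vandermonde] at h
  rw [← Matrix.det_transpose]
  have h2 : (Matrix.of fun i j : Fin r => ∏ p ∈ range i, (U p - u j)).transpose =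
      Matrix.of fun i j => (P j).eval (-u i) := by
    ext i j
    simp only [Matrix.transpose_apply, Matrix.of_apply, P, Polynomial.eval_prod,
      Polynomial.eval_add, Polynomial.eval_X, Polynomial.eval_C]
    exact Finset.prod_congr rfl fun p _ => by ring
  rw [h2, ← h]
  exact Finset.prod_congr rfl fun i _ => Finset.prod_congr rfl fun j _ => by ring

/-- A product over pairs of a symmetric function is invariant under permutations. -/
theorem prod_pairs_comp_perm {r : ℕ} (f : ℕ → ℕ → ℝ) (hf : ∀ x y, f x y = f y x)
    (k : Fin r → ℕ) (σ : Equiv.Perm (Fin r)) :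
    ∏ i, ∏ j ∈ Ioi i, f ((k ∘ σ) i) ((k ∘ σ) j) = ∏ i, ∏ j ∈ Ioi i, f (k i) (k j) := by
  rw [Finset.prod_sigma', Finset.prod_sigma']
  refine Finset.prod_bij'
    (fun x _ => if σ x.1 < σ x.2 then ⟨σ x.1, σ x.2⟩ else ⟨σ x.2, σ x.1⟩)
    (fun x _ => if σ.symm x.1 < σ.symm x.2 then ⟨σ.symm x.1, σ.symm x.2⟩
      else ⟨σ.symm x.2, σ.symm x.1⟩) ?_ ?_ ?_ ?_ ?_
  · rintro ⟨i, j⟩ hx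
    simp only [mem_sigma, mem_univ, mem_Ioi, true_and] at hx ⊢
    have : σ i ≠ σ j := σ.injective.ne hx.ne
    split_ifs with h
    · exact h
    · exact lt_of_le_of_ne (not_lt.1 h) this.symm
  · rintro ⟨i, j⟩ hx
    simp only [mem_sigma, mem_univ, mem_Ioi, true_and] at hx ⊢
    have : σ.symm i ≠ σ.symm j := σ.symm.injective.ne hx.ne
    split_ifs with h
    · exact h
    · exact lt_of_le_of_ne (not_lt.1 h) this.symm
  · rintro ⟨i, j⟩ hx
    simp only [mem_sigma, mem_univ, mem_Ioi, true_and] at hx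
    by_cases h : σ i < σ j
    · simp [h, hx]
    · simp [h, hx.not_gt]
  · rintro ⟨i, j⟩ hx
    simp only [mem_sigma, mem_univ, mem_Ioi, true_and] at hx
    by_cases h : σ.symm i < σ.symm j
    · simp [h, hx]
    · simp [h, hx.not_gt]
  · rintro ⟨i, j⟩ hx
    simp only [Function.comp]
    split_ifs
    · rfl
    · exact hf _ _

/-- `hC` makes the matrix of differences of the `g (L - p)` a polynomial matrix in the `u (t j)` up
to row and column factors, and `hrec` makes its determinants summable by `sum_strictChains_det`. -/
theorem sum_prod_abs_sub_mul {r L : ℕ} (hr : r ≤ L + 1) (α u W C : ℕ → ℝ) (g : ℕ → ℕ → ℝ)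
    (hα : StrictMono α) (hα0 : ∀ t, 0 < α t) (hu : StrictMono u)
    (hrec : ∀ l t, g l (t + 1) * (α l + α t) = g l t * (α l - α t))
    (hC : ∀ p < r, ∀ t ≤ L, g (L - p) t - g (L - p) (t + 1) =
      C p * W t * ∏ i ∈ range p, (u (L - i) - u t)) :
    (∑ t ∈ Fintype.piFinset (fun _ : Fin r => range (L + 1)),
      (∏ i, ∏ j ∈ Ioi i, |u (t i) - u (t j)|) * ∏ i, W (t i)) * ∏ p : Fin r, C p =
    (r.factorial : ℝ) * ((∏ p : Fin r, g (L - p) 0) * ∏ i : Fin r, ∏ j ∈ Ioi i,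
      ((α (L - i) - α (L - j)) / (α (L - i) + α (L - j)))) := by
  -- The recurrence at `t = l` has right-hand side zero, and the zero then propagates. This gives
  -- the boundary condition at `L + 1`.
  have hvan : ∀ l t, l < t → g l t = 0 := by
    intro l t h
    induction t, h using Nat.le_induction with
    | base =>
      have h := hrec l l
      rw [sub_self, mul_zero] at h
      exact (mul_eq_zero.1 h).resolve_right (add_pos (hα0 l) (hα0 l)).ne'
    | succ t h ih =>
      have h := hrec l t
      rw [ih, zero_mul] at h
      exact (mul_eq_zero.1 h).resolve_right (add_pos (hα0 l) (hα0 t)).ne'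
  rw [sum_piFinset_eq_factorial_mul, mul_assoc]
  · congr 1
    have main := sum_strictChains_det (L + 1) α (fun t _ => hα0 t) r
      (fun p : Fin r => α (L - p)) (fun p : Fin r => g (L - p))
      (fun i j h => by
        have := hα.injective h
        ext
        omega) (fun _ => hα0 _) (fun i t _ => hrec _ t)
      (fun i => hvan _ _ (by omega)) 0 (Nat.zero_le _)
    -- One sign per pair arises on each side: `u` increases along the chain, while the nodes `α (L -
    -- p)` decrease in `p`. The two signs cancel.
    let ε : ℝ := ∏ i : Fin r, ∏ j ∈ Ioi i, (-1 : ℝ)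
    have hε : ε ≠ 0 := Finset.prod_ne_zero_iff.2 fun i _ =>
      Finset.prod_ne_zero_iff.2 fun j _ => by norm_num
    apply mul_left_cancel₀ hε
    have hs : schurProd (fun p : Fin r => α (L - p)) = ε * ∏ i : Fin r, ∏ j ∈ Ioi i,
        ((α (L - i) - α (L - j)) / (α (L - i) + α (L - j))) := by
      simp only [schurProd, ε, ← Finset.prod_mul_distrib]
      refine Finset.prod_congr rfl fun i _ => Finset.prod_congr rfl fun j _ => ?_
      rw [add_comm (α (L - j)), neg_one_mul, ← neg_div, neg_sub]
    rw [hs] at main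
    rw [mul_left_comm ε (∏ p : Fin r, g (L - p) 0), ← main, Finset.sum_mul, Finset.mul_sum]
    refine Finset.sum_congr rfl fun k hk => ?_
    rw [mem_strictChains] at hk
    have hmat : (Matrix.of fun i j : Fin r => g (L - i) (k j) - g (L - i) (k j + 1)) =
        Matrix.of fun i j : Fin r => C i * (Matrix.of fun i j : Fin r => W (k j) *
          (Matrix.of fun i j : Fin r => ∏ p ∈ range i, (u (L - p) - u (k j))) i j) i j := by
      ext i j
      simp only [Matrix.of_apply]
      rw [hC i i.2 (k j) (by have := (hk.1 j).2; omega)]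
      ring
    rw [hmat, Matrix.det_mul_column, Matrix.det_mul_row,
      det_prod_sub_eq (fun p => u (L - p)) (fun j => u (k j))]
    have habs : ∏ i, ∏ j ∈ Ioi i, (u (k i) - u (k j)) =
        ε * ∏ i, ∏ j ∈ Ioi i, |u (k i) - u (k j)| := by
      simp only [ε, ← Finset.prod_mul_distrib]
      refine Finset.prod_congr rfl fun i _ => Finset.prod_congr rfl fun j hj => ?_
      have : u (k i) < u (k j) := hu (hk.2 (mem_Ioi.1 hj))
      rw [abs_of_neg (by linarith)]
      ring
    rw [habs]
    ring
  · intro k σ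
    congr 1
    · exact prod_pairs_comp_perm (fun x y => |u x - u y|) (fun x y => abs_sub_comm _ _) k σ
    · exact Equiv.prod_comp σ fun i => W (k i)
  · intro k hk
    rw [Function.not_injective_iff] at hk
    obtain ⟨i, j, hij, hne⟩ := hk
    have hz : ∏ i, ∏ j ∈ Ioi i, |u (k i) - u (k j)| = 0 := by
      rcases lt_or_gt_of_ne hne with h | h
      · exact Finset.prod_eq_zero (mem_univ i) (Finset.prod_eq_zero (mem_Ioi.2 h) (by simp [hij]))
      · exact Finset.prod_eq_zero (mem_univ j) (Finset.prod_eq_zero (mem_Ioi.2 h) (by simp [hij]))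
    rw [hz, zero_mul]

/-! ### Folding by the sign symmetry -/

/-- Folding a sum over `{-n, …, n}` onto the positive values, with `n = L + ε / 2`. -/
theorem sum_fin_eq_two_pow_mul {r L ε N : ℕ} (hε : ε = 1 ∨ ε = 2) (hN : N = 2 * L + ε)
    (u' W' u W : ℕ → ℝ) (hmid : ε = 2 → W' (L + 1) = 0)
    (hu1 : ∀ t ≤ L, u' (L - t) = u t) (hu2 : ∀ t ≤ L, u' (L + ε + t) = u t)
    (hW1 : ∀ t ≤ L, W' (L - t) = W t) (hW2 : ∀ t ≤ L, W' (L + ε + t) = W t) :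
    ∑ j : Fin r → Fin (N + 1), (∏ i, ∏ l ∈ Ioi i, |u' (j i) - u' (j l)|) * ∏ i, W' (j i) =
      2 ^ r * ∑ t ∈ Fintype.piFinset (fun _ : Fin r => range (L + 1)),
        (∏ i, ∏ l ∈ Ioi i, |u (t i) - u (t l)|) * ∏ i, W (t i) := by
  classical
  -- For `ε = 2` the midpoint `L + 1` is sent to `0` by truncated subtraction. This does no harm,
  -- since its weight is zero.
  let π : Fin (N + 1) → ℕ := fun x => if (x : ℕ) ≤ L then L - x else x - L - ε
  have hπ : ∀ x, π x ∈ range (L + 1) := by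
    intro x
    have := x.2
    simp only [π, mem_range]
    split_ifs <;> omega
  have hcase : ∀ x : Fin (N + 1), W' x = 0 ∨ u' x = u (π x) := by
    intro x
    by_cases h1 : (x : ℕ) ≤ L
    · right
      have := hu1 (L - x) (by omega)
      rw [show L - (L - (x : ℕ)) = x by omega] at this
      simp [π, h1, this]
    · by_cases h2 : L + ε ≤ (x : ℕ)
      · right
        have := x.2
        have := hu2 (x - L - ε) (by omega)
        rw [show L + ε + ((x : ℕ) - L - ε) = x by omega] at this
        simp [π, h1, this]
      · left
        rw [show (x : ℕ) = L + 1 by omega]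
        exact hmid (by omega)
  have hsum : ∀ t ∈ range (L + 1), ∑ x : Fin (N + 1) with π x = t, W' x = 2 * W t := by
    intro t ht
    rw [mem_range] at ht
    let x1 : Fin (N + 1) := ⟨L - t, by omega⟩
    let x2 : Fin (N + 1) := ⟨L + ε + t, by omega⟩
    have hne : x1 ≠ x2 := by
      intro h
      have := congrArg Fin.val h
      simp only [x1, x2] at this
      omega
    have h : ∑ x ∈ ({x1, x2} : Finset (Fin (N + 1))), W' x =
        ∑ x : Fin (N + 1) with π x = t, W' x := by
      refine Finset.sum_subset ?_ ?_
      · intro x hx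
        simp only [mem_insert, mem_singleton] at hx
        simp only [mem_filter, mem_univ, true_and]
        rcases hx with rfl | rfl
        · simp only [π, x1]
          split_ifs <;> omega
        · simp only [π, x2]
          split_ifs <;> omega
      · intro x hx hx'
        simp only [mem_filter, mem_univ, true_and, π] at hx
        simp only [mem_insert, mem_singleton, Fin.ext_iff, x1, x2, not_or] at hx'
        split_ifs at hx with h1
        · omega
        · rw [show (x : ℕ) = L + 1 by omega]
          exact hmid (by omega)
    rw [← h, Finset.sum_pair hne, hW1 t (by omega), hW2 t (by omega)]
    ring
  have hfold : ∀ j : Fin r → Fin (N + 1),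
      (∏ i, ∏ l ∈ Ioi i, |u' (j i) - u' (j l)|) * ∏ i, W' (j i) =
      (∏ i, ∏ l ∈ Ioi i, |u (π (j i)) - u (π (j l))|) * ∏ i, W' (j i) := by
    intro j
    by_cases hz : ∏ i, W' (j i) = 0
    · rw [hz, mul_zero, mul_zero]
    · replace hz := Finset.prod_ne_zero_iff.1 hz
      have : ∀ i, u' (j i) = u (π (j i)) := fun i => (hcase (j i)).resolve_left (hz i (mem_univ i))
      simp only [this]
  rw [Finset.sum_congr rfl fun j _ => hfold j,
    ← Finset.sum_fiberwise_of_maps_to (t := Fintype.piFinset (fun _ : Fin r => range (L + 1)))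
      (g := fun j i => π (j i)) (fun j _ => Fintype.mem_piFinset.2 fun i => hπ _), Finset.mul_sum]
  refine Finset.sum_congr rfl fun t ht => ?_
  rw [Fintype.mem_piFinset] at ht
  have h1 : ∑ j : Fin r → Fin (N + 1) with (fun i => π (j i)) = t,
      (∏ i, ∏ l ∈ Ioi i, |u (π (j i)) - u (π (j l))|) * ∏ i, W' (j i) =
      (∏ i, ∏ l ∈ Ioi i, |u (t i) - u (t l)|) *
        ∑ j : Fin r → Fin (N + 1) with (fun i => π (j i)) = t, ∏ i, W' (j i) := by
    rw [Finset.mul_sum]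
    refine Finset.sum_congr rfl fun j hj => ?_
    have hj' := (mem_filter.1 hj).2
    simp only [← hj']
  have h2 : (univ.filter fun j : Fin r → Fin (N + 1) => (fun i => π (j i)) = t) =
      Fintype.piFinset fun i => univ.filter fun x => π x = t i := by
    ext j
    simp [funext_iff]
  have h3 := Finset.prod_univ_sum (fun i => univ.filter fun x => π x = t i)
    (fun (_ : Fin r) (x : Fin (N + 1)) => W' x)
  rw [h1, h2, ← h3, Finset.prod_congr rfl fun i _ => hsum (t i) (ht i),
    Finset.prod_mul_distrib, Finset.prod_const, Finset.card_univ, Fintype.card_fin]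
  ring

/-! ### The common summation for factorials and `q`-factorials -/

theorem prod_pairs_eq_prod_range (r : ℕ) (h : ℕ → ℕ → ℝ) :
    ∏ i : Fin r, ∏ j ∈ Ioi i, h i j = ∏ j ∈ range r, ∏ i ∈ range j, h i j := by
  have h1 : ∀ i : Fin r, ∏ j ∈ Ioi i, h i j =
      ∏ j ∈ range r, if (i : ℕ) < j then h i j else 1 := by
    intro i
    rw [← Fin.prod_univ_eq_prod_range (fun j => if (i : ℕ) < j then h i j else 1),
      ← Finset.prod_filter]
    refine Finset.prod_congr ?_ fun _ _ => rfl
    ext; simp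
  rw [Finset.prod_congr rfl fun i _ => h1 i,
    Fin.prod_univ_eq_prod_range (fun i => ∏ j ∈ range r, if i < j then h i j else 1),
    Finset.prod_comm]
  refine Finset.prod_congr rfl fun j hj => ?_
  rw [← Finset.prod_filter]
  refine Finset.prod_congr ?_ fun _ _ => rfl
  ext i
  simp only [mem_filter, mem_range] at hj ⊢
  omega

theorem prod_Icc_one_eq_prod_range (r : ℕ) (h : ℕ → ℝ) :
    ∏ i ∈ Icc 1 r, h i = ∏ p ∈ range r, h (p + 1) := by
  induction r with
  | zero => simp
  | succ r ih => rw [Finset.prod_Icc_succ_top (by omega), ih, Finset.prod_range_succ]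

theorem inv_mul_factorial_like_eq_prod {f F : ℕ → ℝ} (hF : ∀ n, F (n + 1) = f (n + 1) * F n)
    (hF0 : ∀ n, F n ≠ 0) (L ε t p : ℕ) (h : p + t ≤ L) :
    (F (L - p + t + ε) * F (L - p - t))⁻¹ =
      (F (L + t + ε) * F (L - t))⁻¹ * ∏ i ∈ range p, (f (L - i + t + ε) * f (L - i - t)) := by
  induction p with
  | zero => simp
  | succ p ih =>
    rw [Finset.prod_range_succ, ← mul_assoc, ← ih (by omega),
      show L - p + t + ε = (L - (p + 1) + t + ε) + 1 by omega,
      show L - p - t = (L - (p + 1) - t) + 1 by omega, hF, hF]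
    have h1 := hF0 (L - (p + 1) + t + ε + 1)
    have h2 := hF0 (L - (p + 1) - t + 1)
    rw [hF] at h1 h2
    have h3 := left_ne_zero_of_mul h1
    have h4 := left_ne_zero_of_mul h2
    have h5 := hF0 (L - (p + 1) + t + ε)
    have h6 := hF0 (L - (p + 1) - t)
    field_simp

/-- `F` stands for `n!` or `(q;q)_n`, and `f` for its successive ratios. `hy` is the recurrence of
the functions `g`, `hw` identifies their differences with the weight, and `hd` turns shifts in `l`
into linear factors in `u t`. -/
theorem sum_type_B {r L ε N : ℕ} (hr : r ≤ L + 1) (hε : ε = 1 ∨ ε = 2) (hN : N = 2 * L + ε)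
    {f F : ℕ → ℝ} (hF : ∀ n, F (n + 1) = f (n + 1) * F n) (hF0 : ∀ n, F n ≠ 0)
    (α u y w d D u' W' : ℕ → ℝ) (hα : StrictMono α) (hα0 : ∀ t, 0 < α t) (hu : StrictMono u)
    (hy : ∀ l t, t < l →
      y (t + 1) * f (l - t) * (α l + α t) = y t * f (l + t + ε) * (α l - α t))
    (hd : ∀ l t, t ≤ l → f (l + t + ε) * f (l - t) = d l * (u l - u t))
    (hw : ∀ l t, t ≤ l → D l * w t * (α l + α t) = y t * f (l + t + ε) * (2 * α t))
    (hmid : ε = 2 → W' (L + 1) = 0)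
    (hu1 : ∀ t ≤ L, u' (L - t) = u t) (hu2 : ∀ t ≤ L, u' (L + ε + t) = u t)
    (hW1 : ∀ t ≤ L, W' (L - t) = w t * (F (L + t + ε) * F (L - t))⁻¹)
    (hW2 : ∀ t ≤ L, W' (L + ε + t) = w t * (F (L + t + ε) * F (L - t))⁻¹) :
    (∑ j : Fin r → Fin (N + 1), (∏ i, ∏ l ∈ Ioi i, |u' (j i) - u' (j l)|) * ∏ i, W' (j i)) *
      ∏ p ∈ range r, (D (L - p) * ∏ i ∈ range p, d (L - i)) =
    2 ^ r * (r.factorial : ℝ) * ∏ p ∈ range r, (y 0 * (F (L - p + ε - 1) * F (L - p))⁻¹ *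
      ∏ i ∈ range p, ((α (L - i) - α (L - p)) / (α (L - i) + α (L - p)))) := by
  have hε1 : 1 ≤ ε := by omega
  have hf0 : ∀ n, 1 ≤ n → f n ≠ 0 := by
    intro n hn h
    apply hF0 n
    obtain ⟨m, rfl⟩ : ∃ m, n = m + 1 := ⟨n - 1, by omega⟩
    rw [hF, h, zero_mul]
  -- The cutoff is needed because truncated subtraction would make `F (l - t)` equal to `F 0` for `t
  -- > l`, instead of giving a zero reciprocal.
  let g : ℕ → ℕ → ℝ := fun l t =>
    if t ≤ l then y t * (F (l + t + ε - 1) * F (l - t))⁻¹ else 0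
  have hFs : ∀ l t, F (l + t + ε) = f (l + t + ε) * F (l + t + ε - 1) := by
    intro l t
    conv_lhs => rw [show l + t + ε = (l + t + ε - 1) + 1 by omega]
    rw [hF, show l + t + ε - 1 + 1 = l + t + ε by omega]
  have hrec : ∀ l t, g l (t + 1) * (α l + α t) = g l t * (α l - α t) := by
    intro l t
    simp only [g]
    rcases lt_trichotomy t l with h | h | h
    · rw [if_pos (by omega), if_pos (by omega), show l + (t + 1) + ε - 1 = l + t + ε by omega,
        hFs, show l - t = (l - (t + 1)) + 1 by omega, hF, show l - (t + 1) + 1 = l - t by omega]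
      have h1 := hf0 (l + t + ε) (by omega)
      have h2 := hf0 (l - t) (by omega)
      have h3 := hF0 (l + t + ε - 1)
      have h4 := hF0 (l - (t + 1))
      field_simp
      linear_combination hy l t h
    · subst h
      simp
    · rw [if_neg (by omega), if_neg (by omega)]
      simp
  have hdiff : ∀ l t, t ≤ l → g l t - g l (t + 1) = D l * w t * (F (l + t + ε) * F (l - t))⁻¹ := by
    intro l t h
    have hpos : α l + α t ≠ 0 := (add_pos (hα0 l) (hα0 t)).ne'
    apply mul_right_cancel₀ hpos
    rw [sub_mul, hrec]
    simp only [g, if_pos h]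
    rw [hFs]
    have h1 := hf0 (l + t + ε) (by omega)
    have h3 := hF0 (l + t + ε - 1)
    have h4 := hF0 (l - t)
    field_simp
    linear_combination - hw l t h
  have hC : ∀ p < r, ∀ t ≤ L, g (L - p) t - g (L - p) (t + 1) =
      (D (L - p) * ∏ i ∈ range p, d (L - i)) * (w t * (F (L + t + ε) * F (L - t))⁻¹) *
        ∏ i ∈ range p, (u (L - i) - u t) := by
    intro p hp t ht
    by_cases h : p + t ≤ L
    · rw [hdiff _ _ (by omega), inv_mul_factorial_like_eq_prod hF hF0 L ε t p h,
        Finset.prod_congr rfl fun i hi => hd (L - i) t (by have := mem_range.1 hi; omega),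
        Finset.prod_mul_distrib]
      ring
    -- Beyond the cutoff of `g (L - p)` the polynomial has a root at `u t`, so both sides vanish.
    · rw [Finset.prod_eq_zero (f := fun i => u (L - i) - u t) (i := L - t)
        (mem_range.2 (by omega)) (by rw [show L - (L - t) = t by omega, sub_self]), mul_zero]
      simp only [g]
      rw [if_neg (by omega), if_neg (by omega), sub_zero]
  have main := sum_prod_abs_sub_mul hr α u (fun t => w t * (F (L + t + ε) * F (L - t))⁻¹)
    (fun p => D (L - p) * ∏ i ∈ range p, d (L - i)) g hα hα0 hu hrec hC
  rw [sum_fin_eq_two_pow_mul hε hN u' W' u (fun t => w t * (F (L + t + ε) * F (L - t))⁻¹)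
    hmid hu1 hu2 hW1 hW2, mul_assoc, ← Fin.prod_univ_eq_prod_range
      (fun p => D (L - p) * ∏ i ∈ range p, d (L - i)), main,
    prod_pairs_eq_prod_range r (fun i j => (α (L - i) - α (L - j)) / (α (L - i) + α (L - j))),
    Fin.prod_univ_eq_prod_range (fun p => g (L - p) 0), ← Finset.prod_mul_distrib, mul_assoc]
  simp [g]

/-! ### The case `q = 1` -/

theorem exists_half_decomposition {r N : ℕ} {n : ℝ} (hN : (N : ℝ) = 2 * n) (hr : 1 ≤ r)
    (hn : (r : ℝ) - 1 / 2 ≤ n) :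
    ∃ L ε : ℕ, (ε = 1 ∨ ε = 2) ∧ N = 2 * L + ε ∧ r ≤ L + 1 ∧ n = L + (ε : ℝ) / 2 ∧
      ⌈n⌉ = (L : ℤ) + 1 := by
  have h : 2 * r ≤ N + 1 := by
    have : (2 * r : ℝ) ≤ N + 1 := by linarith
    exact_mod_cast this
  obtain ⟨L, ε, hε, hNL⟩ : ∃ L ε : ℕ, (ε = 1 ∨ ε = 2) ∧ N = 2 * L + ε := by
    rcases Nat.even_or_odd' N with ⟨k, hk | hk⟩
    · exact ⟨k - 1, 2, Or.inr rfl, by omega⟩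
    · exact ⟨k, 1, Or.inl rfl, hk⟩
  have hnL : n = L + (ε : ℝ) / 2 := by
    have : (N : ℝ) = 2 * L + ε := by exact_mod_cast hNL
    linarith
  refine ⟨L, ε, hε, hNL, by omega, hnL, ?_⟩
  rw [Int.ceil_eq_iff, hnL]
  push_cast
  rcases hε with rfl | rfl <;> constructor <;> norm_num

/-- Legendre's duplication formula for both parities at once; it is applied with `l = L - p`, where
`N - 2p = 2l + ε`. -/
theorem factorial_eq_two_pow_mul_prod (l ε : ℕ) (hε : ε = 1 ∨ ε = 2) :
    2 * ((2 * l + ε).factorial : ℝ) =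
      2 ^ (2 * l + ε) * ((l + ε - 1).factorial : ℝ) * ∏ i ∈ range l, ((i : ℝ) + 3 / 2) := by
  induction l with
  | zero => rcases hε with rfl | rfl <;> norm_num
  | succ l ih =>
    rw [Finset.prod_range_succ, show 2 * (l + 1) + ε = 2 * l + ε + 1 + 1 by ring,
      show l + 1 + ε - 1 = (l + ε - 1) + 1 by omega, Nat.factorial_succ, Nat.factorial_succ,
      Nat.factorial_succ (l + ε - 1), pow_succ, pow_succ, show l + ε - 1 + 1 = l + ε by omega]
    push_cast
    rcases hε with rfl | rfl
    · push_cast at ih ⊢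
      linear_combination (2 * (l : ℝ) + 2) * (2 * l + 3) * ih
    · push_cast at ih ⊢
      linear_combination (2 * (l : ℝ) + 4) * (2 * l + 3) * ih

theorem Gamma_add_three_halves (l : ℕ) :
    Real.Gamma ((l : ℝ) + 3 / 2) = (∏ i ∈ range l, ((i : ℝ) + 3 / 2)) * Real.Gamma (3 / 2) := by
  induction l with
  | zero => simp
  | succ l ih =>
    rw [Finset.prod_range_succ, show ((l + 1 : ℕ) : ℝ) + 3 / 2 = (l + 3 / 2) + 1 by push_cast; ring,
      Real.Gamma_add_one (by positivity), ih]
    ring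

theorem factorial_eq_mul_prod_sub {f F : ℕ → ℝ} (hF : ∀ n, F (n + 1) = f (n + 1) * F n)
    (A p : ℕ) (h : p ≤ A) : F A = F (A - p) * ∏ i ∈ range p, f (A - i) := by
  induction p with
  | zero => simp
  | succ p ih =>
    rw [Finset.prod_range_succ, ih (by omega), show A - p = (A - (p + 1)) + 1 by omega, hF]
    ring

theorem discreteMM_two_half_one (r N L ε : ℕ) (hε : ε = 1 ∨ ε = 2) (hN : N = 2 * L + ε)
    (hr : r ≤ L + 1) :
    discreteMM r N 2 (1 / 2) 1 = 2 ^ r * (r.factorial : ℝ) * ∏ p ∈ range r,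
      (((N.factorial : ℝ) / 2) / (((L - p + ε - 1).factorial : ℝ) * ((L - p).factorial : ℝ)) *
        ((p.factorial : ℝ) * ((N - 2 * p).factorial : ℝ) / ((N - p).factorial : ℝ))) := by
  have hNr : (N : ℝ) = 2 * L + ε := by exact_mod_cast hN
  have hε1 : (0 : ℝ) < ε := by rcases hε with rfl | rfl <;> norm_num
  have hF : ∀ n : ℕ, (((n + 1).factorial : ℕ) : ℝ) = ((n + 1 : ℕ) : ℝ) * (n.factorial : ℝ) := by
    intro n
    rw [Nat.factorial_succ]
    push_cast
    ring
  have hchoose : ∀ t ≤ L, ((N.choose (L + ε + t) : ℕ) : ℝ) =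
      N.factorial * (((L + t + ε).factorial : ℝ) * ((L - t).factorial : ℝ))⁻¹ := by
    intro t ht
    rw [Nat.cast_choose ℝ (by omega), show N - (L + ε + t) = L - t by omega,
      show L + ε + t = L + t + ε by ring]
    rfl
  -- With `k = t + ε/2`: `α = 2k`, `u = k^2`, `y = 1`. The factor `N!` of the binomial coefficient
  -- is put into `w` and compensated in `D`.
  have main := sum_type_B (r := r) hr hε hN (f := fun n => (n : ℝ))
    (F := fun n => (n.factorial : ℝ)) hF (fun n => by positivity)
    (fun t => 2 * t + ε) (fun t => ((t : ℝ) + ε / 2) ^ 2) (fun _ => 1)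
    (fun t => ((t : ℝ) + ε / 2) * N.factorial) (fun _ => 1) (fun _ => 2 / N.factorial)
    (fun x => ((x : ℝ) - N / 2) ^ 2) (fun x => |(x : ℝ) - N / 2| * (N.choose x : ℝ))
    (by
      intro a b hab
      have : (a : ℝ) < b := by exact_mod_cast hab
      simp only
      linarith)
    (fun t => by positivity)
    (by
      intro a b hab
      have : (a : ℝ) < b := by exact_mod_cast hab
      simp only
      gcongr)
    (by
      intro l t h
      rw [Nat.cast_sub h.le]
      push_cast
      ring)
    (by
      intro l t h
      rw [Nat.cast_sub h]
      push_cast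
      ring)
    (by
      intro l t h
      have : (N.factorial : ℝ) ≠ 0 := by positivity
      push_cast
      field_simp
      ring)
    (by
      intro h
      subst h
      rw [hNr]
      push_cast
      rw [show (L : ℝ) + 1 - (2 * L + 2) / 2 = 0 by ring]
      simp)
    (by
      intro t ht
      rw [hNr, Nat.cast_sub ht]
      ring)
    (by
      intro t ht
      rw [hNr]
      push_cast
      ring)
    (by
      intro t ht
      have h1 : N.choose (L - t) = N.choose (L + ε + t) := by
        rw [← Nat.choose_symm (by omega : L + ε + t ≤ N)]
        congr 1
        omega
      rw [h1, hchoose t ht, hNr, Nat.cast_sub ht, show (L : ℝ) - t - (2 * L + ε) / 2 =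
        -((t : ℝ) + ε / 2) by ring, abs_neg, abs_of_pos (by positivity)]
      ring)
    (by
      intro t ht
      rw [hchoose t ht, hNr]
      push_cast
      rw [show (L : ℝ) + ε + t - (2 * L + ε) / 2 = (t : ℝ) + ε / 2 by ring,
        abs_of_pos (by positivity)]
      ring)
  have hsum : discreteMM r N 2 (1 / 2) 1 =
      ∑ j : Fin r → Fin (N + 1),
        (∏ i, ∏ l ∈ Ioi i, |(((j i : ℕ) : ℝ) - N / 2) ^ 2 - (((j l : ℕ) : ℝ) - N / 2) ^ 2|) *
          ∏ i, (|((j i : ℕ) : ℝ) - N / 2| * (N.choose (j i) : ℝ)) := by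
    rw [discreteMM]
    refine Finset.sum_congr rfl fun j _ => ?_
    rw [show (2 : ℝ) * (1 / 2) = 1 by norm_num, Real.rpow_one]
    simp only [Real.rpow_one, vdm, kTuple, Finset.abs_prod]
  rw [← hsum] at main
  have hD : ∏ p ∈ range r, ((2 : ℝ) / N.factorial * ∏ i ∈ range p, (1 : ℝ)) ≠ 0 :=
    Finset.prod_ne_zero_iff.2 fun p _ => by
      rw [Finset.prod_const_one, mul_one]
      positivity
  apply mul_right_cancel₀ hD
  rw [main, mul_assoc, mul_assoc, ← Finset.prod_mul_distrib, mul_assoc]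
  congr 2
  refine Finset.prod_congr rfl fun p hp => ?_
  have hp' : p < r := mem_range.1 hp
  have h1 : ∏ i ∈ range p, ((2 * ((L - i : ℕ) : ℝ) + ε - (2 * ((L - p : ℕ) : ℝ) + ε)) /
      (2 * ((L - i : ℕ) : ℝ) + ε + (2 * ((L - p : ℕ) : ℝ) + ε))) =
      (∏ i ∈ range p, ((p - i : ℕ) : ℝ)) / ∏ i ∈ range p, ((N - p - i : ℕ) : ℝ) := by
    rw [← Finset.prod_div_distrib]
    refine Finset.prod_congr rfl fun i hi => ?_
    have hi' : i < p := mem_range.1 hi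
    rw [Nat.cast_sub (by omega : i ≤ L), Nat.cast_sub (by omega : p ≤ L),
      Nat.cast_sub (by omega : i ≤ N - p), Nat.cast_sub (by omega : p ≤ N),
      Nat.cast_sub (by omega : i ≤ p), hNr]
    rw [show (2 : ℝ) * (L - i) + ε - (2 * (L - p) + ε) = 2 * (p - i) by ring,
      show (2 : ℝ) * (L - i) + ε + (2 * (L - p) + ε) = 2 * (2 * L + ε - p - i) by ring,
      mul_div_mul_left _ _ (two_ne_zero)]
  have h2 := factorial_eq_mul_prod_sub (f := fun n => (n : ℝ))
    (F := fun n => (n.factorial : ℝ)) hF p p le_rfl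
  have h3 := factorial_eq_mul_prod_sub (f := fun n => (n : ℝ))
    (F := fun n => (n.factorial : ℝ)) hF (N - p) p (by omega)
  simp only [Nat.sub_self, Nat.factorial_zero, Nat.cast_one, one_mul] at h2
  rw [show N - p - p = N - 2 * p by omega] at h3
  rw [h1, ← h2, h3, Finset.prod_const_one]
  have h4 : ∏ i ∈ range p, ((N - p - i : ℕ) : ℝ) ≠ 0 :=
    Finset.prod_ne_zero_iff.2 fun i hi => by
      have hi' : i < p := mem_range.1 hi
      exact Nat.cast_ne_zero.2 (by omega)
  field_simp

theorem discreteMM_eq_prod_Gamma (r N L ε : ℕ) (hε : ε = 1 ∨ ε = 2) (hN : N = 2 * L + ε)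
    (hr : r ≤ L + 1) :
    discreteMM r N 2 (1 / 2) 1 =
      (2 : ℝ) ^ (((N : ℝ) + 1) * r - r * (r + 1)) *
        ∏ i ∈ Finset.Icc 1 r,
          ((Real.Gamma (1 + i) / Real.Gamma (3 / 2)) *
            ((Real.Gamma ((N : ℝ) + 1) * Real.Gamma ((L : ℝ) + 1 - i + 3 / 2)) /
              (Real.Gamma ((N : ℝ) - i + 2) * Real.Gamma ((L : ℝ) + 1 - i + 1)))) := by
  rw [discreteMM_two_half_one r N L ε hε hN hr, prod_Icc_one_eq_prod_range]
  have hNr : (N : ℝ) = 2 * L + ε := by exact_mod_cast hN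
  have hpow : (2 : ℝ) ^ (((N : ℝ) + 1) * r - r * (r + 1)) =
      ∏ p ∈ range r, (2 : ℝ) ^ ((N : ℝ) - 1 - 2 * p) := by
    rw [← Real.rpow_sum_of_pos two_pos]
    congr 1
    clear hr
    induction r with
    | zero => simp
    | succ r ih =>
      rw [Finset.sum_range_succ, ← ih]
      push_cast
      ring
  have hfac : (r.factorial : ℝ) = ∏ p ∈ range r, ((p + 1 : ℕ) : ℝ) := by
    rw [← Finset.prod_range_add_one_eq_factorial]
    push_cast
    rfl
  have h2 : (2 : ℝ) ^ r = ∏ p ∈ range r, (2 : ℝ) := by simp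
  rw [hpow, hfac, h2, ← Finset.prod_mul_distrib, ← Finset.prod_mul_distrib,
    ← Finset.prod_mul_distrib]
  refine Finset.prod_congr rfl fun p hp => ?_
  have hp' : p < r := mem_range.1 hp
  obtain ⟨l, rfl⟩ : ∃ l, L = l + p := ⟨L - p, by omega⟩
  have e1 : Real.Gamma (1 + ((p + 1 : ℕ) : ℝ)) = ((p + 1).factorial : ℝ) := by
    rw [add_comm, Real.Gamma_nat_eq_factorial]
  have e2 : Real.Gamma (((l + p : ℕ) : ℝ) + 1 - ((p + 1 : ℕ) : ℝ) + 3 / 2) =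
      (∏ i ∈ range l, ((i : ℝ) + 3 / 2)) * Real.Gamma (3 / 2) := by
    rw [← Gamma_add_three_halves]
    push_cast
    ring_nf
  have e3 : Real.Gamma (((l + p : ℕ) : ℝ) + 1 - ((p + 1 : ℕ) : ℝ) + 1) = (l.factorial : ℝ) := by
    rw [← Real.Gamma_nat_eq_factorial]
    push_cast
    ring_nf
  have e4 : Real.Gamma ((N : ℝ) - ((p + 1 : ℕ) : ℝ) + 2) = ((N - p).factorial : ℝ) := by
    rw [← Real.Gamma_nat_eq_factorial, Nat.cast_sub (by omega)]
    push_cast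
    ring_nf
  have e5 : (2 : ℝ) ^ ((N : ℝ) - 1 - 2 * p) = 2 ^ (2 * l + ε) / 2 := by
    rw [← Real.rpow_natCast, ← Real.rpow_sub_one two_ne_zero, hNr]
    push_cast
    ring_nf
  have e6 := factorial_eq_two_pow_mul_prod l ε hε
  rw [e1, e2, e3, e4, e5, Real.Gamma_nat_eq_factorial, show l + p - p = l by omega,
    show N - 2 * p = 2 * l + ε by omega, Nat.factorial_succ]
  have g1 : Real.Gamma (3 / 2) ≠ 0 := (Real.Gamma_pos_of_pos (by norm_num)).ne'
  have e7 : ((2 * l + ε).factorial : ℝ) =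
      2 ^ (2 * l + ε) * ((l + ε - 1).factorial : ℝ) * (∏ i ∈ range l, ((i : ℝ) + 3 / 2)) / 2 := by
    linarith
  rw [e7]
  push_cast
  field_simp

/-! ### `q`-factorials, `q`-gamma values and `q`-duplication -/

/-- `(q;q)_n` as a finite product. -/
noncomputable def qFact (q : ℝ) (n : ℕ) : ℝ := ∏ k ∈ range n, (1 - q ^ (k + 1))

theorem qFact_succ (q : ℝ) (n : ℕ) : qFact q (n + 1) = (1 - q ^ (n + 1)) * qFact q n := by
  rw [qFact, qFact, Finset.prod_range_succ, mul_comm]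

theorem qFact_zero (q : ℝ) : qFact q 0 = 1 := by simp [qFact]

theorem one_sub_pow_pos {q : ℝ} (h0 : 0 < q) (h1 : q < 1) {n : ℕ} (hn : n ≠ 0) :
    0 < 1 - q ^ n := sub_pos.2 (pow_lt_one₀ h0.le h1 hn)

theorem qFact_ne_zero {q : ℝ} (h0 : 0 < q) (h1 : q < 1) (n : ℕ) : qFact q n ≠ 0 :=
  Finset.prod_ne_zero_iff.2 fun _ _ => (one_sub_pow_pos h0 h1 (Nat.succ_ne_zero _)).ne'

theorem qPoch_natCast (a q : ℝ) (n : ℕ) : qPoch a q n = ∏ k ∈ range n, (1 - a * q ^ k) := rfl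

theorem qPoch_neg_one (a q : ℝ) : qPoch a q (-1) = (1 - a / q)⁻¹ := by
  change qPoch a q (Int.negSucc 0) = _
  simp [qPoch]

theorem qPoch_self_natCast (q : ℝ) (n : ℕ) : qPoch q q n = qFact q n := by
  rw [qPoch_natCast, qFact]
  exact Finset.prod_congr rfl fun k _ => by ring

theorem qBinom_eq {q : ℝ} (h0 : 0 < q) (h1 : q < 1) {N m : ℕ} (h : m ≤ N) :
    qBinom q N m = qFact q N / (qFact q m * qFact q (N - m)) := by
  have hnum : qPoch (q ^ ((N : ℤ) - m + 1)) q m * qFact q (N - m) = qFact q N := by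
    obtain ⟨d, rfl⟩ : ∃ d, N = d + m := ⟨N - m, by omega⟩
    rw [qPoch_natCast, show ((d + m : ℕ) : ℤ) - m + 1 = ((d + 1 : ℕ) : ℤ) by push_cast; ring,
      zpow_natCast, Nat.add_sub_cancel, qFact, qFact, Finset.prod_range_add, mul_comm]
    congr 1
    exact Finset.prod_congr rfl fun k _ => by ring
  have h2 := qFact_ne_zero h0 h1 m
  have h3 := qFact_ne_zero h0 h1 (N - m)
  rw [qBinom, qPoch_self_natCast, ← hnum]
  field_simp

theorem qPochInf_eq_mul (a q : ℝ) (h0 : 0 < q) (h1 : q < 1) :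
    qPochInf a q = (1 - a) * qPochInf (a * q) q := by
  rw [qPochInf, qPochInf]
  have h := multipliable_qPochInf (a * q) q h0 h1
  have e : (fun k : ℕ => 1 - a * q * q ^ k) = fun k => 1 - a * q ^ (k + 1) := by
    funext k; ring
  rw [e] at h ⊢
  rw [tprod_eq_zero_mul' (f := fun k : ℕ => 1 - a * q ^ k) h]
  simp

theorem qPochInf_ne_zero {a q : ℝ} (ha0 : 0 ≤ a) (ha : a < 1) (h0 : 0 < q) (h1 : q < 1) :
    qPochInf a q ≠ 0 := by
  have h := tprod_one_add_ne_zero_of_summable (f := fun k : ℕ => -(a * q ^ k)) ?_ ?_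
  · simpa [qPochInf, sub_eq_add_neg] using h
  · intro k
    have h2 : a * q ^ k < 1 := by
      have := pow_le_one₀ h0.le h1.le (n := k)
      nlinarith [pow_pos h0 k]
    have : 1 + -(a * q ^ k) > 0 := by linarith
    exact this.ne'
  · exact ((summable_geometric_of_lt_one h0.le h1).mul_left a).neg.norm

theorem qGamma_add_one {q x : ℝ} (h0 : 0 < q) (h1 : q < 1) (hx : 0 < x) :
    qGamma q (x + 1) = (1 - q ^ x) / (1 - q) * qGamma q x := by
  have hqx : 1 - q ^ x ≠ 0 := (sub_pos.2 (Real.rpow_lt_one h0.le h1 hx)).ne'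
  have hq : 0 < 1 - q := sub_pos.2 h1
  rw [qGamma, qGamma, qPochInf_eq_mul (q ^ x) q h0 h1, ← Real.rpow_add_one h0.ne',
    show 1 - (x + 1) = (1 - x) - 1 by ring, Real.rpow_sub_one hq.ne']
  have := qPochInf_ne_zero (a := q ^ (x + 1)) (by positivity)
    (Real.rpow_lt_one h0.le h1 (by linarith)) h0 h1
  field_simp

theorem qGamma_ne_zero {q x : ℝ} (h0 : 0 < q) (h1 : q < 1) (hx : 0 < x) : qGamma q x ≠ 0 := by
  have hq : 0 < 1 - q := sub_pos.2 h1
  exact div_ne_zero (mul_ne_zero (Real.rpow_pos_of_pos hq _).ne' (qPochInf_ne_zero h0.le h1 h0 h1))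
    (qPochInf_ne_zero (by positivity) (Real.rpow_lt_one h0.le h1 hx) h0 h1)

theorem qGamma_natCast_add_one {q : ℝ} (h0 : 0 < q) (h1 : q < 1) (n : ℕ) :
    qGamma q ((n : ℝ) + 1) = qFact q n / (1 - q) ^ n := by
  have hq : 0 < 1 - q := sub_pos.2 h1
  induction n with
  | zero =>
    have := qPochInf_ne_zero h0.le h1 h0 h1
    simp [qGamma, qFact, this]
  | succ n ih =>
    push_cast
    rw [qGamma_add_one h0 h1 (by positivity), ih, qFact_succ, pow_succ (1 - q) n]
    have : q ^ ((n : ℝ) + 1) = q ^ (n + 1) := by exact_mod_cast Real.rpow_natCast q (n + 1)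
    rw [this]
    field_simp

theorem rpow_sq_eq {s : ℝ} (hs : 0 < s) (x : ℝ) : (s ^ 2) ^ x = s ^ (2 * x) := by
  rw [← Real.rpow_natCast, ← Real.rpow_mul hs.le]
  norm_num

theorem qGamma_add_three_halves {s : ℝ} (h0 : 0 < s) (h1 : s < 1) (l : ℕ) :
    qGamma (s ^ 2) ((l : ℝ) + 3 / 2) =
      (∏ i ∈ range l, (1 - s ^ (2 * i + 3))) / (1 - s ^ 2) ^ l * qGamma (s ^ 2) (3 / 2) := by
  have hq0 : 0 < s ^ 2 := by positivity
  have hq1 : s ^ 2 < 1 := pow_lt_one₀ h0.le h1 two_ne_zero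
  have hq : 0 < 1 - s ^ 2 := sub_pos.2 hq1
  induction l with
  | zero => simp
  | succ l ih =>
    rw [Finset.prod_range_succ, show ((l + 1 : ℕ) : ℝ) + 3 / 2 = (l + 3 / 2) + 1 by push_cast; ring,
      qGamma_add_one hq0 hq1 (by positivity), ih, pow_succ (1 - s ^ 2) l]
    have : (s ^ 2) ^ ((l : ℝ) + 3 / 2) = s ^ (2 * l + 3) := by
      rw [rpow_sq_eq h0, ← Real.rpow_natCast s (2 * l + 3)]
      push_cast
      ring_nf
    rw [this]
    field_simp

theorem qPoch_neg_sq_step {s : ℝ} (h0 : 0 < s) (l ε : ℕ) (hε : ε = 1 ∨ ε = 2) :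
    qPoch (-s ^ 2) s (((2 * (l + 1) + ε : ℕ) : ℤ) - 2) =
      qPoch (-s ^ 2) s (((2 * l + ε : ℕ) : ℤ) - 2) *
        ((1 + s ^ (2 * l + ε)) * (1 + s ^ (2 * l + ε + 1))) := by
  rw [show ((2 * (l + 1) + ε : ℕ) : ℤ) - 2 = ((2 * l + ε : ℕ) : ℤ) by push_cast; ring,
    qPoch_natCast]
  -- The index `2l + ε - 2` equals `-1` when `l = 0` and `ε = 1`; there the negative-index
  -- convention gives `(1 + s)⁻¹`.
  by_cases h : 2 ≤ 2 * l + ε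
  · obtain ⟨m, hm⟩ : ∃ m, 2 * l + ε = m + 2 := ⟨2 * l + ε - 2, by omega⟩
    rw [hm, show ((m + 2 : ℕ) : ℤ) - 2 = (m : ℤ) by push_cast; ring, qPoch_natCast,
      Finset.prod_range_succ, Finset.prod_range_succ]
    ring
  · obtain ⟨rfl, rfl⟩ : l = 0 ∧ ε = 1 := by omega
    have : 1 + s ≠ 0 := by positivity
    have h2 : 1 - -s ^ 2 / s = 1 + s := by field_simp; ring
    norm_num [qPoch_neg_one]
    rw [h2]
    field_simp

/-- A form of the `q`-duplication formula. -/
theorem qFact_two_mul_add {s : ℝ} (h0 : 0 < s) (l ε : ℕ) (hε : ε = 1 ∨ ε = 2) :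
    qFact (s ^ 2) (2 * l + ε) =
      (1 - s ^ 2) * (1 + s ^ (2 * l + ε)) * qFact (s ^ 2) (l + ε - 1) *
        qPoch (-s ^ 2) s (((2 * l + ε : ℕ) : ℤ) - 2) * ∏ i ∈ range l, (1 - s ^ (2 * i + 3)) := by
  induction l with
  | zero =>
    rcases hε with rfl | rfl
    · have h1 : 1 + s ≠ 0 := by positivity
      have h2 : 1 - -s ^ 2 / s = 1 + s := by field_simp; ring
      norm_num [qPoch_neg_one, qFact]
      rw [h2]
      field_simp
    · have : qPoch (-s ^ 2) s 0 = 1 := by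
        have := qPoch_natCast (-s ^ 2) s 0
        simpa using this
      norm_num [qFact, Finset.prod_range_succ, this]
      ring
  | succ l ih =>
    rw [qPoch_neg_sq_step h0 l ε hε, Finset.prod_range_succ,
      show 2 * (l + 1) + ε = 2 * l + ε + 1 + 1 by ring,
      show l + 1 + ε - 1 = (l + ε - 1) + 1 by omega, qFact_succ, qFact_succ, ih,
      qFact_succ _ (l + ε - 1), show l + ε - 1 + 1 = l + ε by omega]
    rcases hε with rfl | rfl <;> ring

/-! ### The `q`-sum -/

theorem sum_Ioi_sub {r : ℕ} (i : Fin r) :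
    ∑ l ∈ Ioi i, ((l : ℝ) - (i : ℕ)) = ((r : ℝ) - 1 - (i : ℕ)) * (r - (i : ℕ)) / 2 := by
  have h1 : ∑ l ∈ Ioi i, ((l : ℝ) - (i : ℕ)) =
      ∑ j ∈ range r, if (i : ℕ) < j then (j : ℝ) - (i : ℕ) else 0 := by
    rw [← Fin.sum_univ_eq_sum_range (fun j => if (i : ℕ) < j then (j : ℝ) - (i : ℕ) else 0),
      ← Finset.sum_filter]
    refine Finset.sum_congr ?_ fun _ _ => rfl
    ext; simp
  rw [h1]
  generalize hi : (i : ℕ) = a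
  have ha : a < r := hi ▸ i.2
  clear h1 hi i
  induction r, ha using Nat.le_induction with
  | base =>
    rw [Finset.sum_eq_zero]
    · push_cast; ring
    · intro j hj
      rw [if_neg]
      have := mem_range.1 hj
      omega
  | succ r hr ih =>
    rw [Finset.sum_range_succ, ih, if_pos (by omega)]
    push_cast
    ring

theorem abs_qNum_mul_qNum {q : ℝ} (h0 : 0 < q) (h1 : q < 1) (a b : ℝ) :
    |qNum q (a - b) * qNum q (a + b)| =
      q ^ a / (1 - q) ^ 2 * |(q ^ a + q ^ (-a)) - (q ^ b + q ^ (-b))| := by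
  have hq : 0 < 1 - q := sub_pos.2 h1
  have ha : 0 < q ^ a := Real.rpow_pos_of_pos h0 _
  have hb : 0 < q ^ b := Real.rpow_pos_of_pos h0 _
  have hpos : 0 < q ^ a / (1 - q) ^ 2 := by positivity
  rw [← abs_of_pos hpos, ← abs_mul]
  congr 1
  rw [qNum, qNum, Real.rpow_sub h0, Real.rpow_add h0, Real.rpow_neg h0.le, Real.rpow_neg h0.le]
  field_simp
  ring

/-- The pairs whose smaller index is `i` (counted from one) release `q^((r-i) k_i)`. This cancels
the linear term caused by the shift in `binom(k_i - r + i, 2)`, so the remaining summand is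
symmetric and the rest is a constant. -/
theorem qSumB_eq_mul_sum {q : ℝ} (h0 : 0 < q) (h1 : q < 1) (r N : ℕ) :
    qSumB q r N = (∏ i : Fin r, ∏ l ∈ Ioi i, (q ^ ((l : ℝ) - (i : ℕ)) / (1 - q) ^ 2)) *
      ∑ j : Fin r → Fin (N + 1),
        (∏ i, ∏ l ∈ Ioi i,
          |(q ^ (((j i : ℕ) : ℝ) - N / 2) + q ^ (-(((j i : ℕ) : ℝ) - N / 2))) -
            (q ^ (((j l : ℕ) : ℝ) - N / 2) + q ^ (-(((j l : ℕ) : ℝ) - N / 2)))|) *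
        ∏ i, (|qNum q (((j i : ℕ) : ℝ) - N / 2)| *
          q ^ (choose2 (((j i : ℕ) : ℝ) - N / 2) - choose2 ((⌈(N : ℝ) / 2⌉ : ℝ) - (N : ℝ) / 2)) *
          qBinom q N (j i)) := by
  rw [qSumB, Finset.mul_sum]
  refine Finset.sum_congr rfl fun j _ => ?_
  rw [← mul_assoc, ← Finset.prod_mul_distrib, ← Finset.prod_mul_distrib, ← Finset.prod_mul_distrib]
  refine Finset.prod_congr rfl fun i _ => ?_
  simp only [kTuple]
  generalize (((j i : ℕ) : ℝ) - N / 2) = k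
  have hexp : q ^ (choose2 (k - r + ((i : ℕ) + 1)) -
        choose2 ((⌈(N : ℝ) / 2⌉ : ℝ) - (N : ℝ) / 2)) * ∏ l ∈ Ioi i, q ^ k =
      (∏ l ∈ Ioi i, q ^ ((l : ℝ) - (i : ℕ))) *
        q ^ (choose2 k - choose2 ((⌈(N : ℝ) / 2⌉ : ℝ) - (N : ℝ) / 2)) := by
    rw [← Real.rpow_sum_of_pos h0, ← Real.rpow_sum_of_pos h0, ← Real.rpow_add h0,
      ← Real.rpow_add h0, sum_Ioi_sub, Finset.sum_const, Fin.card_Ioi, nsmul_eq_mul,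
      Nat.cast_sub (by have := i.2; omega), Nat.cast_sub (by have := i.2; omega)]
    congr 1
    simp only [choose2]
    push_cast
    ring
  rw [Finset.prod_congr rfl fun l _ => abs_qNum_mul_qNum h0 h1 k _, Finset.prod_mul_distrib,
    Finset.prod_div_distrib, Finset.prod_div_distrib]
  linear_combination (∏ l ∈ Ioi i, (1 - q) ^ 2)⁻¹ *
    (∏ l ∈ Ioi i, |(q ^ k + q ^ (-k)) - (q ^ (((j l : ℕ) : ℝ) - N / 2) +
      q ^ (-(((j l : ℕ) : ℝ) - N / 2)))|) * |qNum q k| * qBinom q N (j i) * hexp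

theorem choose2_ceil_half {N L ε : ℕ} (hε : ε = 1 ∨ ε = 2) (hN : N = 2 * L + ε) :
    choose2 ((⌈(N : ℝ) / 2⌉ : ℝ) - (N : ℝ) / 2) = choose2 ((ε : ℝ) / 2) := by
  have hc : ⌈(N : ℝ) / 2⌉ = (L : ℤ) + 1 := by
    rw [Int.ceil_eq_iff, hN]
    push_cast
    rcases hε with rfl | rfl <;> constructor <;> push_cast <;> linarith
  rw [hc, hN]
  simp only [choose2]
  push_cast
  ring

theorem qSumB_eq_prod {s : ℝ} (h0 : 0 < s) (h1 : s < 1) (r N L ε : ℕ) (hε : ε = 1 ∨ ε = 2)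
    (hN : N = 2 * L + ε) (hr : r ≤ L + 1) :
    qSumB (s ^ 2) r N = 2 ^ r * (r.factorial : ℝ) * ∏ p ∈ range r,
      (qFact (s ^ 2) N / ((1 - s ^ 2) * (1 + s ^ (2 * (L - p) + ε))) /
        (qFact (s ^ 2) (L - p + ε - 1) * qFact (s ^ 2) (L - p)) *
        (qFact (s ^ 2) p * qFact (s ^ 2) (N - 2 * p) /
          (qFact (s ^ 2) (N - p) * (1 - s ^ 2) ^ (2 * p)))) := by
  have hNr : (N : ℝ) = 2 * L + ε := by exact_mod_cast hN
  have hq0 : 0 < s ^ 2 := by positivity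
  have hq1 : s ^ 2 < 1 := pow_lt_one₀ h0.le h1 two_ne_zero
  have hq : 0 < 1 - s ^ 2 := sub_pos.2 hq1
  have hε0 : ε ≠ 0 := by omega
  have hF := qFact_succ (s ^ 2)
  have hF0 := qFact_ne_zero hq0 hq1
  let z : ℕ → ℝ := fun t => s ^ (2 * t + ε)
  have hz0 : ∀ t, 0 < z t := fun t => pow_pos h0 _
  have hz1 : ∀ t, z t < 1 := fun t => pow_lt_one₀ h0.le h1 (by omega)
  have hzlt : ∀ a b, a < b → z b < z a := fun a b h =>
    pow_lt_pow_right_of_lt_one₀ h0 h1 (by omega)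
  have hzz : ∀ l t, z l * z t = (s ^ 2) ^ (l + t + ε) := by
    intro l t
    simp only [z]
    rw [← pow_add, ← pow_mul]
    congr 1
    ring
  have hzd : ∀ l t, t ≤ l → z l = z t * (s ^ 2) ^ (l - t) := by
    intro l t h
    simp only [z]
    rw [← pow_mul, ← pow_add]
    congr 1
    omega
  have hzr : ∀ t : ℕ, (s ^ 2) ^ ((t : ℝ) + ε / 2) = z t := by
    intro t
    simp only [z]
    rw [rpow_sq_eq h0, ← Real.rpow_natCast s (2 * t + ε)]
    push_cast
    ring_nf
  have hzr' : ∀ t : ℕ, (s ^ 2) ^ (-((t : ℝ) + ε / 2)) = (z t)⁻¹ := by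
    intro t
    rw [Real.rpow_neg hq0.le, hzr]
  let y : ℕ → ℝ := fun t => (s ^ 2) ^ (choose2 ((t : ℝ) + ε / 2) - choose2 ((ε : ℝ) / 2))
  have hysucc : ∀ t, y (t + 1) = y t * z t := by
    intro t
    rw [← hzr]
    simp only [y]
    rw [← Real.rpow_add hq0]
    congr 1
    simp only [choose2]
    push_cast
    ring
  have hy0 : y 0 = 1 := by simp [y]
  have hbin : ∀ t ≤ L, qBinom (s ^ 2) N (L + ε + t) =
      qFact (s ^ 2) N * (qFact (s ^ 2) (L + t + ε) * qFact (s ^ 2) (L - t))⁻¹ := by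
    intro t ht
    rw [qBinom_eq hq0 hq1 (by omega), show N - (L + ε + t) = L - t by omega,
      show L + ε + t = L + t + ε by ring, div_eq_mul_inv]
  have hbin' : ∀ t ≤ L, qBinom (s ^ 2) N (L - t) =
      qFact (s ^ 2) N * (qFact (s ^ 2) (L + t + ε) * qFact (s ^ 2) (L - t))⁻¹ := by
    intro t ht
    rw [qBinom_eq hq0 hq1 (by omega), show N - (L - t) = L + t + ε by omega, div_eq_mul_inv,
      mul_comm (qFact (s ^ 2) (L - t))]
  have hk1 : ∀ t ≤ L, ((L - t : ℕ) : ℝ) - N / 2 = -((t : ℝ) + ε / 2) := by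
    intro t ht
    rw [hNr, Nat.cast_sub ht]
    ring
  have hk2 : ∀ t : ℕ, ((L + ε + t : ℕ) : ℝ) - N / 2 = (t : ℝ) + ε / 2 := by
    intro t
    rw [hNr]
    push_cast
    ring
  have hα : ∀ l t, ((1 - z l) / (1 + z l) + (1 - z t) / (1 + z t)) =
      2 * (1 - z l * z t) / ((1 + z l) * (1 + z t)) := by
    intro l t
    have := hz0 l
    have := hz0 t
    field_simp
    ring
  have hα' : ∀ l t, ((1 - z l) / (1 + z l) - (1 - z t) / (1 + z t)) =
      2 * (z t - z l) / ((1 + z l) * (1 + z t)) := by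
    intro l t
    have := hz0 l
    have := hz0 t
    field_simp
    ring
  -- Here `z t = q^k` with `k = t + ε/2` and `q = s^2`. The recurrence holds because `(α l - α t)/(α
  -- l + α t) = (z t - z l)/(1 - z l z t)`, whose numerator contains the factor `z t = y (t+1) / y
  -- t`.
  have main := sum_type_B (r := r) hr hε hN (f := fun n => 1 - (s ^ 2) ^ n)
    (F := qFact (s ^ 2)) hF hF0
    (fun t => (1 - z t) / (1 + z t)) (fun t => z t + (z t)⁻¹) y
    (fun t => (1 - z t) / (1 - s ^ 2) * y t * qFact (s ^ 2) N) z
    (fun t => (1 + z t) * (1 - s ^ 2) / qFact (s ^ 2) N)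
    (fun x => (s ^ 2) ^ ((x : ℝ) - N / 2) + (s ^ 2) ^ (-((x : ℝ) - N / 2)))
    (fun x => |qNum (s ^ 2) ((x : ℝ) - N / 2)| *
      (s ^ 2) ^ (choose2 ((x : ℝ) - N / 2) - choose2 ((⌈(N : ℝ) / 2⌉ : ℝ) - (N : ℝ) / 2)) *
          qBinom (s ^ 2) N x)
    (by
      intro a b hab
      have := hzlt a b hab
      have ha := hz0 a
      have hb := hz0 b
      simp only
      rw [div_lt_div_iff₀ (by positivity) (by positivity)]
      nlinarith)
    (fun t => div_pos (sub_pos.2 (hz1 t)) (by have := hz0 t; positivity))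
    (by
      intro a b hab
      have hlt := hzlt a b hab
      have ha := hz0 a
      have hb := hz0 b
      have ha1 := hz1 a
      have hb1 := hz1 b
      simp only
      have e : z b + (z b)⁻¹ - (z a + (z a)⁻¹) = (z a - z b) * (1 - z a * z b) / (z a * z b) := by
        field_simp
        ring
      have : 0 < z b + (z b)⁻¹ - (z a + (z a)⁻¹) := by
        rw [e]
        have h1 : 0 < z a - z b := sub_pos.2 hlt
        have h2 : 0 < 1 - z a * z b := by nlinarith
        positivity
      linarith)
    (by
      intro l t h
      rw [hα, hα', ← hzz, hysucc, hzd l t h.le]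
      ring)
    (by
      intro l t h
      have ha := hz0 l
      have hb := hz0 t
      have hd := hzd l t h
      have hd' : (s ^ 2) ^ (l - t) = z l / z t := by
        rw [hd]
        field_simp
      rw [← hzz, hd']
      field_simp
      ring)
    (by
      intro l t h
      have ha := hz0 l
      have hb := hz0 t
      have hFN := hF0 N
      rw [hα, ← hzz]
      field_simp)
    (by
      intro h
      subst h
      rw [hNr]
      push_cast
      rw [show (L : ℝ) + 1 - (2 * L + 2) / 2 = 0 by ring]
      simp [qNum])
    (by
      intro t ht
      rw [hk1 t ht, neg_neg, hzr, hzr', add_comm])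
    (by
      intro t ht
      rw [hk2 t, hzr, hzr'])
    (by
      intro t ht
      rw [hk1 t ht, hbin' t ht, choose2_ceil_half hε hN, qNum, hzr']
      have ha := hz0 t
      -- Since `binom(-k,2) = binom(k,2) + k`, the extra `q^k` offsets `|[-k]_q| = q^(-k) [k]_q`.
      -- Hence `k` and `-k` have equal weight.
      have hy : (s ^ 2) ^ (choose2 (-((t : ℝ) + ε / 2)) - choose2 ((ε : ℝ) / 2)) = y t * z t := by
        rw [← hzr]
        simp only [y]
        rw [← Real.rpow_add hq0]
        congr 1
        simp only [choose2]
        ring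
      have habs : |(1 - (z t)⁻¹) / (1 - s ^ 2)| = (1 - z t) / (1 - s ^ 2) / z t := by
        rw [abs_of_nonpos]
        · field_simp
          ring
        · refine div_nonpos_of_nonpos_of_nonneg ?_ hq.le
          rw [sub_nonpos]
          exact (one_le_inv₀ ha).2 (hz1 t).le
      rw [hy, habs]
      field_simp)
    (by
      intro t ht
      rw [hk2 t, hbin t ht, choose2_ceil_half hε hN, qNum, hzr,
        abs_of_pos (div_pos (sub_pos.2 (hz1 t)) hq)]
      simp only [y]
      ring)
  rw [qSumB_eq_mul_sum hq0 hq1, prod_pairs_eq_prod_range r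
    (fun i l => (s ^ 2) ^ ((l : ℝ) - (i : ℝ)) / (1 - s ^ 2) ^ 2)]
  have hD : ∏ p ∈ range r, ((1 + z (L - p)) * (1 - s ^ 2) / qFact (s ^ 2) N *
      ∏ i ∈ range p, z (L - i)) ≠ 0 :=
    Finset.prod_ne_zero_iff.2 fun p _ => by
      have h1 := hz0 (L - p)
      have h2 : ∏ i ∈ range p, z (L - i) ≠ 0 := Finset.prod_ne_zero_iff.2 fun i _ => (hz0 _).ne'
      have h3 := hF0 N
      have h4 : 1 + z (L - p) ≠ 0 := by positivity
      exact mul_ne_zero (div_ne_zero (mul_ne_zero h4 hq.ne') h3) h2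
  apply mul_right_cancel₀ hD
  rw [mul_assoc, main, mul_left_comm, mul_assoc (2 ^ r * (r.factorial : ℝ)), ← Finset.prod_mul_distrib,
    ← Finset.prod_mul_distrib]
  congr 1
  refine Finset.prod_congr rfl fun p hp => ?_
  have hp' : p < r := mem_range.1 hp
  have h1 : (∏ i ∈ range p, ((s ^ 2) ^ ((p : ℝ) - (i : ℝ)) / (1 - s ^ 2) ^ 2)) *
      ∏ i ∈ range p, (((1 - z (L - i)) / (1 + z (L - i)) - (1 - z (L - p)) / (1 + z (L - p))) /
      ((1 - z (L - i)) / (1 + z (L - i)) + (1 - z (L - p)) / (1 + z (L - p)))) =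
      (∏ i ∈ range p, (1 - (s ^ 2) ^ (p - i))) / (∏ i ∈ range p, (1 - (s ^ 2) ^ (N - p - i))) /
        (1 - s ^ 2) ^ (2 * p) * ∏ i ∈ range p, z (L - i) := by
    have h2 : (1 - s ^ 2) ^ (2 * p) = ∏ i ∈ range p, (1 - s ^ 2) ^ 2 := by
      rw [Finset.prod_const, card_range, pow_mul]
    rw [h2, ← Finset.prod_mul_distrib, ← Finset.prod_div_distrib, ← Finset.prod_div_distrib,
      ← Finset.prod_mul_distrib]
    refine Finset.prod_congr rfl fun i hi => ?_
    have hi' : i < p := mem_range.1 hi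
    have e1 : (s ^ 2) ^ ((p : ℝ) - (i : ℝ)) = (s ^ 2) ^ (p - i) := by
      rw [← Nat.cast_sub hi'.le, Real.rpow_natCast]
    have e2 := hzd (L - i) (L - p) (by omega)
    rw [show L - i - (L - p) = p - i by omega] at e2
    have e3 := hzz (L - i) (L - p)
    rw [show L - i + (L - p) + ε = N - p - i by omega] at e3
    rw [e1, hα, hα', ← e3, e2]
    have ha := hz0 (L - p)
    have hb := hz0 (L - i)
    rw [e2] at hb
    have hc : 1 - z (L - p) * (s ^ 2) ^ (p - i) * z (L - p) ≠ 0 := by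
      have := hz1 (L - p)
      have hb1 := hz1 (L - i)
      rw [e2] at hb1
      have : 0 < 1 - z (L - p) * (s ^ 2) ^ (p - i) * z (L - p) := by nlinarith
      exact this.ne'
    have hd : 1 + z (L - p) ≠ 0 := by positivity
    have he : 1 + z (L - p) * (s ^ 2) ^ (p - i) ≠ 0 := by positivity
    have hq' := hq.ne'
    field_simp
  rw [mul_left_comm, h1, hy0]
  have h2 := factorial_eq_mul_prod_sub (f := fun n => 1 - (s ^ 2) ^ n) hF p p le_rfl
  have h3 := factorial_eq_mul_prod_sub (f := fun n => 1 - (s ^ 2) ^ n) hF (N - p) p (by omega)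
  rw [Nat.sub_self, qFact_zero, one_mul] at h2
  rw [show N - p - p = N - 2 * p by omega] at h3
  have h4 := hF0 (N - p)
  rw [h3] at h4
  have h5 := right_ne_zero_of_mul h4
  have h6 := left_ne_zero_of_mul h4
  rw [← h2, h3]
  have h7 := hF0 N
  have h8 : 1 + z (L - p) ≠ 0 := by have := hz0 (L - p); positivity
  have h9 : z (L - p) = s ^ (2 * (L - p) + ε) := rfl
  rw [← h9]
  have h10 := hq.ne'
  field_simp

theorem qSumB_eq_prod_qGamma {s : ℝ} (h0 : 0 < s) (h1 : s < 1) (r N L ε : ℕ)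
    (hε : ε = 1 ∨ ε = 2) (hN : N = 2 * L + ε) (hr : r ≤ L + 1) :
    qSumB (s ^ 2) r N = 2 ^ r * (r.factorial : ℝ) * ∏ i ∈ Finset.Icc 1 r,
      (qPoch (-s ^ 2) s ((N : ℤ) - 2 * i) *
        (qGamma (s ^ 2) i / qGamma (s ^ 2) (3 / 2)) *
        ((qGamma (s ^ 2) ((N : ℝ) + 1) * qGamma (s ^ 2) ((L : ℝ) + 1 - i + 3 / 2)) /
          (qGamma (s ^ 2) ((N : ℝ) - i + 2) * qGamma (s ^ 2) ((L : ℝ) + 1 - i + 1)))) := by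
  rw [qSumB_eq_prod h0 h1 r N L ε hε hN hr, prod_Icc_one_eq_prod_range]
  have hq0 : 0 < s ^ 2 := by positivity
  have hq1 : s ^ 2 < 1 := pow_lt_one₀ h0.le h1 two_ne_zero
  have hq : 1 - s ^ 2 ≠ 0 := (sub_pos.2 hq1).ne'
  have hF0 := qFact_ne_zero hq0 hq1
  congr 1
  refine Finset.prod_congr rfl fun p hp => ?_
  have hp' : p < r := mem_range.1 hp
  obtain ⟨l, rfl⟩ : ∃ l, L = l + p := ⟨L - p, by omega⟩
  have e1 : qGamma (s ^ 2) ((p + 1 : ℕ) : ℝ) = qFact (s ^ 2) p / (1 - s ^ 2) ^ p := by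
    rw [← qGamma_natCast_add_one hq0 hq1]
    push_cast
    rfl
  have e2 : qGamma (s ^ 2) (((l + p : ℕ) : ℝ) + 1 - ((p + 1 : ℕ) : ℝ) + 3 / 2) =
      (∏ i ∈ range l, (1 - s ^ (2 * i + 3))) / (1 - s ^ 2) ^ l * qGamma (s ^ 2) (3 / 2) := by
    rw [← qGamma_add_three_halves h0 h1]
    push_cast
    congr 1
    ring
  have e3 : qGamma (s ^ 2) (((l + p : ℕ) : ℝ) + 1 - ((p + 1 : ℕ) : ℝ) + 1) =
      qFact (s ^ 2) l / (1 - s ^ 2) ^ l := by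
    rw [← qGamma_natCast_add_one hq0 hq1]
    push_cast
    congr 1
    ring
  have e4 : qGamma (s ^ 2) ((N : ℝ) - ((p + 1 : ℕ) : ℝ) + 2) =
      qFact (s ^ 2) (N - p) / (1 - s ^ 2) ^ (N - p) := by
    rw [← qGamma_natCast_add_one hq0 hq1, Nat.cast_sub (by omega)]
    push_cast
    congr 1
    ring
  -- The factor `1 + s^(2l+ε)` in this formula cancels the one in the denominator coming from `D (L
  -- - p)`.
  have e5 := qFact_two_mul_add h0 l ε hε
  have e6 : (N : ℤ) - 2 * ((p + 1 : ℕ) : ℤ) = ((2 * l + ε : ℕ) : ℤ) - 2 := by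
    rw [hN]
    push_cast
    ring
  have e7 : (1 - s ^ 2) ^ N = (1 - s ^ 2) ^ (N - p) * (1 - s ^ 2) ^ p := by
    rw [← pow_add]
    congr 1
    omega
  rw [e1, e2, e3, e4, e6, qGamma_natCast_add_one hq0 hq1, show l + p - p = l by omega,
    show N - 2 * p = 2 * l + ε by omega, e5, e7]
  have g1 := qGamma_ne_zero hq0 hq1 (x := 3 / 2) (by norm_num)
  have g2 := hF0 l
  have g3 := hF0 (N - p)
  have g4 := hF0 (l + ε - 1)
  have g5 : 1 + s ^ (2 * l + ε) ≠ 0 := by positivity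
  field_simp
  ring

end MacdonaldMehta

theorem proposition5p2 (r : ℕ) (hr : 1 ≤ r) (n : ℝ) (N : ℕ) (hN : (N : ℝ) = 2 * n)
    (hn : (r : ℝ) - 1 / 2 ≤ n) :
    (∀ q : ℝ, 0 < q → q < 1 →
      MacdonaldMehta.qSumB q r N =
        2 ^ r * (Nat.factorial r : ℝ) *
          ∏ i ∈ Finset.Icc 1 r,
            (MacdonaldMehta.qPoch (-q) (q ^ (1 / 2 : ℝ)) ((N : ℤ) - 2 * i) *
              (MacdonaldMehta.qGamma q i / MacdonaldMehta.qGamma q (3 / 2)) *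
              ((MacdonaldMehta.qGamma q (2 * n + 1) *
                  MacdonaldMehta.qGamma q ((⌈n⌉ : ℝ) - i + 3 / 2)) /
                (MacdonaldMehta.qGamma q (2 * n - i + 2) *
                  MacdonaldMehta.qGamma q ((⌈n⌉ : ℝ) - i + 1))))) ∧
    MacdonaldMehta.discreteMM r N 2 (1 / 2) 1 =
      (2 : ℝ) ^ ((2 * n + 1) * r - r * (r + 1)) *
        ∏ i ∈ Finset.Icc 1 r,
          ((Real.Gamma (1 + i) / Real.Gamma (3 / 2)) *
            ((Real.Gamma (2 * n + 1) * Real.Gamma ((⌈n⌉ : ℝ) - i + 3 / 2)) /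
              (Real.Gamma (2 * n - i + 2) * Real.Gamma ((⌈n⌉ : ℝ) - i + 1)))) := by
  obtain ⟨L, ε, hε, hNL, hrL, -, hceil⟩ := MacdonaldMehta.exists_half_decomposition hN hr hn
  rw [← hN, hceil]
  push_cast
  refine ⟨fun q h0 h1 => ?_, MacdonaldMehta.discreteMM_eq_prod_Gamma r N L ε hε hNL hrL⟩
  -- With `s = q^(1/2)`, half-integral powers of `q` become natural powers of `s`.
  have hs0 : 0 < q ^ (1 / 2 : ℝ) := Real.rpow_pos_of_pos h0 _
  have hs1 : q ^ (1 / 2 : ℝ) < 1 := Real.rpow_lt_one h0.le h1 (by norm_num)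
  have hs : (q ^ (1 / 2 : ℝ)) ^ 2 = q := by
    rw [← Real.rpow_natCast, ← Real.rpow_mul h0.le]
    norm_num
  have h := MacdonaldMehta.qSumB_eq_prod_qGamma hs0 hs1 r N L ε hε hNL hrL
  rw [hs] at h
  exact h
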